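/- **Theorem.** All graphs are finite and simple. For a graph $G$, a set $S\subseteq V(G)$ is *2-dominating* if every vertex outside $S$ has at least two neighbours in $S$, and *2-independent* if every vertex of $S$ has at most one neighbour in $S$; $\gamma_2(G)$ is the minimum cardinality of a 2-dominating set and $\alpha_2(G)$ the maximum cardinality of a 2-independent set. *Special trees.* Each of the following trees has exactly one white vertex, all its other vertices being black, and a specified vertex $v$. Write $P_n$ for the path $0,1,\dots,n-1$. - $T_1$: $P_3$, white $1$, $v=1$. $T_2$: $P_3$, white $2$, $v=2$. $T_3$: $P_4$, white $3$, $v=1$. $T_4$: $P_4$, white $1$, $v=3$. $T_5$: $P_5$, white $1$, $v=1$. $T_6$: $P_5$, white $4$, $v=v_2=4$, $v_1=0$. $T_7$: $P_6$, white $5$, $v=3$. $T_8$: $P_6$, white $1$, $v=1$. $T_9$: $P_7$, white $6$, $v=6$. $T_{10}$: $P_7$, white $3$, $v=3$. - $T_{11}$: edges $01,02,03,34,45,56$, white $0$, $v=6$. - $T_{12}$: edges $01,12,23,34,15,06$, white $0$, $v=5$. $T_{13}$: the same coloured tree with $v=6$. - $T_{14}$: edges $01,12,23,34,45,26,17$,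 white $0$, $v=v_1=0$, $v_2=1$. - $T_{15}$: edges $01,12,23,14,25,36,37$, white $3$, $v=0$. A *PDI-subtree* (prescribed-degree-induced subtree) $S$ of a tree $T'$, where $S$ is a special tree, is an induced subgraph of $T'$ isomorphic to $S$ (with colours and specified vertices transferred along an isomorphism) such that every black vertex has the same degree in $T'$ as in $S$. Let $\mathcal T$ be the smallest family of trees, closed under isomorphism, that contains all trees of order at most $4$ and is closed under the following operations, each of which turns a tree $T'$ into a tree $T$ (the vertices $u,u_1,u_2,u_3$ are new): - $\mathcal O_1$: let $v=v(S)$ for a PDI-subtree $S\in\{T_1,T_2,T_8\}$ of $T'$; add a vertex $u$ and the edge $vu$. - $\mathcal O_2$: let $v=v(S)$ for a PDI-subtree $S\in\{T_4,T_{11},T_{12},T_{13},T_{15}\}$ of $T'$; add a path $u_1u_2$ and the edge $vu_1$. - $\mathcal O_3$: let $v$ be any vertex of $T'$; add a path $u_1u_2u_3$ and the edge $vu_2$. - $\mathcal O_4$: let $v=v(S)$ for a PDI-subtree $S\in\{T_1,T_2,T_3,T_5,T_6,T_7,T_9,T_{10},T_{14}\}$ of $T'$; add a path $u_1u_2u_3$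 and the edge $vu_1$. - $\mathcal O_5$: let $v_1,v_2$ be the specified vertices of a PDI-subtree $T_6$ of $T'$; add a path $u_1u_3$ and the edge $v_1u_1$, and add a vertex $u_2$ and the edge $v_2u_2$. - $\mathcal O_6$: let $v_1,v_2$ be the specified vertices of a PDI-subtree $T_{14}$ of $T'$; remove the edge $v_1v_2$ and add a path $u_1u_2u_3$ and the edges $v_1u_1$ and $v_2u_2$. Then a tree $T$ satisfies $\gamma_2(T)=\alpha_2(T)$ if and only if $T\in\mathcal T$. -/

import Mathlib

universe u

namespace TwoDom

/-- `S` is a `k`-dominating set: every vertex outside `S` has at least `k` neighbours in `S`. -/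
def IsKDominating {V : Type u} (G : SimpleGraph V) (k : ℕ) (S : Set V) : Prop :=
  ∀ v, v ∉ S → k ≤ (G.neighborSet v ∩ S).ncard

/-- `S` is a `k`-independent set: every vertex of `S` has at most `k - 1` neighbours in `S`. -/
def IsKIndependent {V : Type u} (G : SimpleGraph V) (k : ℕ) (S : Set V) : Prop :=
  ∀ v, v ∈ S → (G.neighborSet v ∩ S).ncard < k

/-- The `k`-domination number of a finite graph. -/
noncomputable def kDominationNumber {V : Type u} (G : SimpleGraph V) (k : ℕ) : ℕ :=
  sInf {n | ∃ S : Set V, IsKDominating G k S ∧ S.ncard = n}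

/-- The `k`-independence number of a finite graph. -/
noncomputable def kIndependenceNumber {V : Type u} (G : SimpleGraph V) (k : ℕ) : ℕ :=
  sSup {n | ∃ S : Set V, IsKIndependent G k S ∧ S.ncard = n}

/-- The graph on `Fin n` with the listed edges. -/
def edgeGraph (n : ℕ) (l : List (Fin n × Fin n)) : SimpleGraph (Fin n) :=
  SimpleGraph.fromRel fun a b => (a, b) ∈ l

/-- A special tree, with its unique white vertex (all other vertices are black) and its
specified vertex `v`. -/
structure SpecialTree where
  order : ℕ
  graph : SimpleGraph (Fin order)
  white : Fin order
  v : Fin order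

/-- Black, white, black along a path; `v` is the (white) centre. -/
def T₁ : SpecialTree := ⟨3, edgeGraph 3 [(0, 1), (1, 2)], 1, 1⟩

def T₂ : SpecialTree := ⟨3, edgeGraph 3 [(0, 1), (1, 2)], 2, 2⟩

def T₃ : SpecialTree := ⟨4, edgeGraph 4 [(0, 1), (1, 2), (2, 3)], 3, 1⟩

def T₄ : SpecialTree := ⟨4, edgeGraph 4 [(0, 1), (1, 2), (2, 3)], 1, 3⟩

def T₅ : SpecialTree := ⟨5, edgeGraph 5 [(0, 1), (1, 2), (2, 3), (3, 4)], 1, 1⟩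

/-- Here `v = v₂` is the white end of the path; `v₁` is the other end. -/
def T₆ : SpecialTree := ⟨5, edgeGraph 5 [(0, 1), (1, 2), (2, 3), (3, 4)], 4, 4⟩

def T₇ : SpecialTree := ⟨6, edgeGraph 6 [(0, 1), (1, 2), (2, 3), (3, 4), (4, 5)], 5, 3⟩

def T₈ : SpecialTree := ⟨6, edgeGraph 6 [(0, 1), (1, 2), (2, 3), (3, 4), (4, 5)], 1, 1⟩

def T₉ : SpecialTree := ⟨7, edgeGraph 7 [(0, 1), (1, 2), (2, 3), (3, 4), (4, 5), (5, 6)], 6, 6⟩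

def T₁₀ : SpecialTree := ⟨7, edgeGraph 7 [(0, 1), (1, 2), (2, 3), (3, 4), (4, 5), (5, 6)], 3, 3⟩

/-- The white vertex `0` carries two leaves and a pendant path `3, 4, 5, 6`. -/
def T₁₁ : SpecialTree := ⟨7, edgeGraph 7 [(0, 1), (0, 2), (0, 3), (3, 4), (4, 5), (5, 6)], 0, 6⟩

/-- The path `0, 1, 2, 3, 4` starting at the white vertex, with a leaf `5` at `1` and a leaf `6`
at `0`; here `v` is the leaf at `1`. -/
def T₁₂ : SpecialTree := ⟨7, edgeGraph 7 [(0, 1), (1, 2), (2, 3), (3, 4), (1, 5), (0, 6)], 0, 5⟩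

/-- The same coloured tree as `T₁₂`; here `v` is the leaf at the white vertex. -/
def T₁₃ : SpecialTree := ⟨7, edgeGraph 7 [(0, 1), (1, 2), (2, 3), (3, 4), (1, 5), (0, 6)], 0, 6⟩

/-- The path `0, 1, 2, 3, 4, 5` starting at the white vertex `v = v₁`, with a leaf `6` at `2` and
a leaf `7` at `v₂ = 1`. -/
def T₁₄ : SpecialTree :=
  ⟨8, edgeGraph 8 [(0, 1), (1, 2), (2, 3), (3, 4), (4, 5), (2, 6), (1, 7)], 0, 0⟩

/-- The path `0, 1, 2, 3` ending at the white vertex, with a leaf at `1`, a leaf at `2` and two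
leaves at `3`. -/
def T₁₅ : SpecialTree :=
  ⟨8, edgeGraph 8 [(0, 1), (1, 2), (2, 3), (1, 4), (2, 5), (3, 6), (3, 7)], 3, 0⟩

/-- The vertex `v₁` of `T₆`. -/
def T₆v₁ : Fin T₆.order := (0 : Fin 5)

/-- The vertex `v₂` of `T₆`. -/
def T₆v₂ : Fin T₆.order := (4 : Fin 5)

/-- The vertex `v₁` of `T₁₄`. -/
def T₁₄v₁ : Fin T₁₄.order := (0 : Fin 8)

/-- The vertex `v₂` of `T₁₄`. -/
def T₁₄v₂ : Fin T₁₄.order := (1 : Fin 8)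

/-- The induced copy `e` of the special tree `S` in `G` is a prescribed-degree-induced subtree:
every black vertex has the same degree in `G` as in `S`. -/
def IsPDI {V : Type u} (S : SpecialTree) (G : SimpleGraph V) (e : S.graph ↪g G) : Prop :=
  ∀ x, x ≠ S.white → (G.neighborSet (e x)).ncard = (S.graph.neighborSet x).ncard

/-- `w` is the vertex `v(S)` of some PDI-subtree `S` of `G`. -/
def IsAttacher {V : Type u} (S : SpecialTree) (G : SimpleGraph V) (w : V) : Prop :=
  ∃ e : S.graph ↪g G, IsPDI S G e ∧ w = e S.v

/-- `W` consists of a copy (under `f`) of `V` and the distinct new vertices listed in `l`. -/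
def NewVertices {V W : Type u} (f : V ↪ W) (l : List W) : Prop :=
  l.Nodup ∧ ∀ w, w ∈ l ↔ w ∉ Set.range f

/-- `G` arises from `G'` by adding a vertex `u` and the edge `vu`. -/
def Op₁ {V W : Type u} (G' : SimpleGraph V) (G : SimpleGraph W) : Prop :=
  ∃ S ∈ ({T₁, T₂, T₈} : Set SpecialTree), ∃ v, IsAttacher S G' v ∧
    ∃ (f : V ↪ W) (u : W), NewVertices f [u] ∧
      G = G'.map f ⊔ SimpleGraph.fromEdgeSet {s(f v, u)}

/-- `G` arises from `G'` by adding a path `u₁u₂` and the edge `vu₁`. -/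
def Op₂ {V W : Type u} (G' : SimpleGraph V) (G : SimpleGraph W) : Prop :=
  ∃ S ∈ ({T₄, T₁₁, T₁₂, T₁₃, T₁₅} : Set SpecialTree), ∃ v, IsAttacher S G' v ∧
    ∃ (f : V ↪ W) (u₁ u₂ : W), NewVertices f [u₁, u₂] ∧
      G = G'.map f ⊔ SimpleGraph.fromEdgeSet {s(u₁, u₂), s(f v, u₁)}

/-- `G` arises from `G'` by adding a path `u₁u₂u₃` and the edge `vu₂`, with `v` arbitrary. -/
def Op₃ {V W : Type u} (G' : SimpleGraph V) (G : SimpleGraph W) : Prop :=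
  ∃ (v : V) (f : V ↪ W) (u₁ u₂ u₃ : W), NewVertices f [u₁, u₂, u₃] ∧
    G = G'.map f ⊔ SimpleGraph.fromEdgeSet {s(u₁, u₂), s(u₂, u₃), s(f v, u₂)}

/-- `G` arises from `G'` by adding a path `u₁u₂u₃` and the edge `vu₁`. -/
def Op₄ {V W : Type u} (G' : SimpleGraph V) (G : SimpleGraph W) : Prop :=
  ∃ S ∈ ({T₁, T₂, T₃, T₅, T₆, T₇, T₉, T₁₀, T₁₄} : Set SpecialTree), ∃ v, IsAttacher S G' v ∧
    ∃ (f : V ↪ W) (u₁ u₂ u₃ : W), NewVertices f [u₁, u₂, u₃] ∧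
      G = G'.map f ⊔ SimpleGraph.fromEdgeSet {s(u₁, u₂), s(u₂, u₃), s(f v, u₁)}

/-- `G` arises from `G'` by adding a path `u₁u₃` and the edge `v₁u₁`, and a vertex `u₂` and the
edge `v₂u₂`. -/
def Op₅ {V W : Type u} (G' : SimpleGraph V) (G : SimpleGraph W) : Prop :=
  ∃ e : T₆.graph ↪g G', IsPDI T₆ G' e ∧
    ∃ (f : V ↪ W) (u₁ u₂ u₃ : W), NewVertices f [u₁, u₂, u₃] ∧
      G = G'.map f ⊔ SimpleGraph.fromEdgeSet
        {s(u₁, u₃), s(f (e T₆v₁), u₁), s(f (e T₆v₂), u₂)}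

/-- `G` arises from `G'` by removing the edge `v₁v₂` and adding a path `u₁u₂u₃` and the edges
`v₁u₁` and `v₂u₂`. -/
def Op₆ {V W : Type u} (G' : SimpleGraph V) (G : SimpleGraph W) : Prop :=
  ∃ e : T₁₄.graph ↪g G', IsPDI T₁₄ G' e ∧
    ∃ (f : V ↪ W) (u₁ u₂ u₃ : W), NewVertices f [u₁, u₂, u₃] ∧
      G = (G'.deleteEdges {s(e T₁₄v₁, e T₁₄v₂)}).map f ⊔ SimpleGraph.fromEdgeSet
        {s(u₁, u₂), s(u₂, u₃), s(f (e T₁₄v₁), u₁), s(f (e T₁₄v₂), u₂)}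

/-- The smallest family that contains all trees of order at most `4` and is closed under the six
operations (which are taken up to isomorphism). -/
inductive TreeFamily : ∀ {V : Type u}, SimpleGraph V → Prop
  | small {V : Type u} [Finite V] (G : SimpleGraph V) (hG : G.IsTree) (hV : Nat.card V ≤ 4) :
      TreeFamily G
  | op₁ {V W : Type u} {G' : SimpleGraph V} {G : SimpleGraph W} :
      TreeFamily G' → Op₁ G' G → TreeFamily G
  | op₂ {V W : Type u} {G' : SimpleGraph V} {G : SimpleGraph W} :
      TreeFamily G' → Op₂ G' G → TreeFamily G
  | op₃ {V W : Type u} {G' : SimpleGraph V} {G : SimpleGraph W} :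
      TreeFamily G' → Op₃ G' G → TreeFamily G
  | op₄ {V W : Type u} {G' : SimpleGraph V} {G : SimpleGraph W} :
      TreeFamily G' → Op₄ G' G → TreeFamily G
  | op₅ {V W : Type u} {G' : SimpleGraph V} {G : SimpleGraph W} :
      TreeFamily G' → Op₅ G' G → TreeFamily G
  | op₆ {V W : Type u} {G' : SimpleGraph V} {G : SimpleGraph W} :
      TreeFamily G' → Op₆ G' G → TreeFamily G

end TwoDom

/-!
Root a graph and allow the root a demand `0`, `1`, `2`, `⊤` or a capacity `0`, `1`, `2` in place
of `2`. The resulting seven numbers, the profile of the rooted graph, determine how `γ₂` and `α₂`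
change when other graphs are glued to the root. Each of the operations replaces a rooted piece of
the tree by one whose profile is larger by a constant in every entry, and so preserves `γ₂ = α₂`
in both directions.

For the converse, call `min (α₂ - γ₂)`, taken over the matching pairs of demands and capacities,
the excess of a rooted tree. It is nonnegative and superadditive under gluing, so every branch of
a tree with `γ₂ = α₂` has excess `0`. Building trees up from their branches, a finite computation
shows that a rooted tree of excess `0` either contains the result of an operation as a branch or
is one of `16` normal forms, and those of the latter that satisfy `γ₂ = α₂` have at most four
vertices or admit an inverse operation at another root. Induction on the order of the tree
finishes the proof.
-/

namespace TwoDom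

open Set Function

/-! ### Domination with prescribed demands, independence with prescribed capacities -/

section Demands

variable {V W : Type*} {G : SimpleGraph V} {H : SimpleGraph W} {S : Set V}
  {d : V → ℕ∞} {c : V → ℕ}

/-- The number of neighbours of `v` that lie in `S`. -/
noncomputable def degIn (G : SimpleGraph V) (S : Set V) (v : V) : ℕ := (G.neighborSet v ∩ S).ncard

/-- `S` is `d`-dominating: every vertex `v` outside `S` has at least `d v` neighbours in `S`. On a
finite graph the demand `d v = ⊤` says that `v` belongs to `S`. -/
def IsFDominating (G : SimpleGraph V) (d : V → ℕ∞) (S : Set V) : Prop :=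
  ∀ v ∉ S, d v ≤ degIn G S v

/-- `S` is `c`-independent: every vertex `v` of `S` has fewer than `c v` neighbours in `S`. The
capacity `c v = 0` says that `v` does not belong to `S`. -/
def IsFIndependent (G : SimpleGraph V) (c : V → ℕ) (S : Set V) : Prop :=
  ∀ v ∈ S, degIn G S v < c v

/-- The minimum cardinality of a `d`-dominating set. -/
noncomputable def fDomNumber (G : SimpleGraph V) (d : V → ℕ∞) : ℕ :=
  sInf {n | ∃ S, IsFDominating G d S ∧ S.ncard = n}

/-- The maximum cardinality of a `c`-independent set. -/
noncomputable def fIndNumber (G : SimpleGraph V) (c : V → ℕ) : ℕ :=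
  sSup {n | ∃ S, IsFIndependent G c S ∧ S.ncard = n}

lemma IsFDominating.mono {d' : V → ℕ∞} (h : IsFDominating G d S) (hd : d' ≤ d) :
    IsFDominating G d' S := fun v hv => (hd v).trans (h v hv)

lemma IsFIndependent.mono {c' : V → ℕ} (h : IsFIndependent G c S) (hc : c ≤ c') :
    IsFIndependent G c' S := fun v hv => (h v hv).trans_le (hc v)

lemma IsFDominating.mem_of_eq_top {v : V} (h : IsFDominating G d S) (hv : d v = ⊤) : v ∈ S := by
  by_contra hvS
  simpa [hv] using h v hvS

lemma IsFIndependent.notMem_of_eq_zero {v : V} (h : IsFIndependent G c S) (hv : c v = 0) : v ∉ S :=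
  fun hvS => by simpa [hv] using h v hvS

lemma fDomNumber_le (h : IsFDominating G d S) : fDomNumber G d ≤ S.ncard :=
  Nat.sInf_le ⟨S, h, rfl⟩

lemma exists_ncard_eq_fDomNumber (G : SimpleGraph V) (d : V → ℕ∞) :
    ∃ S, IsFDominating G d S ∧ S.ncard = fDomNumber G d :=
  Nat.sInf_mem (s := {n | ∃ S, IsFDominating G d S ∧ S.ncard = n})
    ⟨_, univ, fun v hv => (hv (mem_univ v)).elim, rfl⟩

section Finite

variable [Finite V]

lemma bddAbove_ncard_isFIndependent (G : SimpleGraph V) (c : V → ℕ) :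
    BddAbove {n | ∃ S, IsFIndependent G c S ∧ S.ncard = n} :=
  ⟨Nat.card V, by rintro n ⟨S, -, rfl⟩; exact S.ncard_le_card⟩

lemma le_fIndNumber (h : IsFIndependent G c S) : S.ncard ≤ fIndNumber G c :=
  le_csSup (bddAbove_ncard_isFIndependent G c) ⟨S, h, rfl⟩

lemma exists_ncard_eq_fIndNumber (G : SimpleGraph V) (c : V → ℕ) :
    ∃ S, IsFIndependent G c S ∧ S.ncard = fIndNumber G c :=
  Nat.sSup_mem (s := {n | ∃ S, IsFIndependent G c S ∧ S.ncard = n})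
    ⟨_, ∅, fun _ hv => hv.elim, rfl⟩ (bddAbove_ncard_isFIndependent G c)

end Finite

lemma degIn_preimage (φ : G ≃g H) (T : Set W) (v : V) :
    degIn G (φ ⁻¹' T) v = degIn H T (φ v) := by
  have : H.neighborSet (φ v) ∩ T = φ '' (G.neighborSet v ∩ φ ⁻¹' T) := by
    ext w
    obtain ⟨x, rfl⟩ := φ.surjective w
    simp [φ.map_adj_iff]
  rw [degIn, degIn, this, ncard_image_of_injective _ φ.injective]

lemma isFDominating_preimage (φ : G ≃g H) {d : W → ℕ∞} {T : Set W} :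
    IsFDominating G (d ∘ φ) (φ ⁻¹' T) ↔ IsFDominating H d T := by
  simp only [IsFDominating, degIn_preimage, φ.surjective.forall, mem_preimage, comp_apply]

lemma isFIndependent_preimage (φ : G ≃g H) {c : W → ℕ} {T : Set W} :
    IsFIndependent G (c ∘ φ) (φ ⁻¹' T) ↔ IsFIndependent H c T := by
  simp only [IsFIndependent, degIn_preimage, φ.surjective.forall, mem_preimage, comp_apply]

lemma ncard_preimage_iso (φ : G ≃g H) (T : Set W) : (φ ⁻¹' T).ncard = T.ncard :=
  ncard_preimage_of_injective_subset_range φ.injective (by simp [φ.surjective.range_eq])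

lemma fDomNumber_comp (φ : G ≃g H) (d : W → ℕ∞) : fDomNumber G (d ∘ φ) = fDomNumber H d := by
  simp only [fDomNumber, φ.injective.preimage_surjective.exists, isFDominating_preimage,
    ncard_preimage_iso]

lemma fIndNumber_comp (φ : G ≃g H) (c : W → ℕ) : fIndNumber G (c ∘ φ) = fIndNumber H c := by
  simp only [fIndNumber, φ.injective.preimage_surjective.exists, isFIndependent_preimage,
    ncard_preimage_iso]

end Demands

section Rooted

variable {V W : Type*} {G : SimpleGraph V} {H : SimpleGraph W} {r : V} {S : Set V}

open Classical in
/-- The demand that asks for `l` at the root `r` and for `2` elsewhere. -/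
noncomputable def rootDemand (r : V) (l : ℕ∞) (v : V) : ℕ∞ :=
  if v = r then l else 2

open Classical in
/-- The capacity that allows `c` at the root `r` and `2` elsewhere. -/
noncomputable def rootCapacity (r : V) (c : ℕ) (v : V) : ℕ :=
  if v = r then c else 2

/-- The minimum cardinality of a set that `2`-dominates every vertex except possibly the root `r`,
which is dominated `l` times. -/
noncomputable def rootedDom (G : SimpleGraph V) (r : V) (l : ℕ∞) : ℕ :=
  fDomNumber G (rootDemand r l)

/-- The maximum cardinality of a set that is `2`-independent except possibly at the root `r`, which
has fewer than `c` neighbours in the set if it belongs to it. -/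
noncomputable def rootedInd (G : SimpleGraph V) (r : V) (c : ℕ) : ℕ :=
  fIndNumber G (rootCapacity r c)

lemma rootDemand_self (r : V) (l : ℕ∞) : rootDemand r l r = l := if_pos rfl

lemma rootCapacity_self (r : V) (c : ℕ) : rootCapacity r c r = c := if_pos rfl

lemma rootDemand_of_ne {v : V} (hv : v ≠ r) (l : ℕ∞) : rootDemand r l v = 2 :=
  if_neg hv

lemma rootCapacity_of_ne {v : V} (hv : v ≠ r) (c : ℕ) : rootCapacity r c v = 2 :=
  if_neg hv

lemma rootDemand_mono (r : V) : Monotone (rootDemand r) := fun _ _ h v => by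
  unfold rootDemand
  split_ifs
  exacts [h, le_rfl]

lemma rootCapacity_mono (r : V) : Monotone (rootCapacity r) := fun _ _ h v => by
  unfold rootCapacity
  split_ifs
  exacts [h, le_rfl]

lemma IsFDominating.of_root_mem {l m : ℕ∞} (h : IsFDominating G (rootDemand r l) S) (hr : r ∈ S) :
    IsFDominating G (rootDemand r m) S := fun v hv => by
  have hvr : v ≠ r := (ne_of_mem_of_not_mem hr hv).symm
  simpa only [rootDemand_of_ne hvr] using h v hv

lemma IsFIndependent.of_root_notMem {c c' : ℕ} (h : IsFIndependent G (rootCapacity r c) S)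
    (hr : r ∉ S) : IsFIndependent G (rootCapacity r c') S := fun v hv => by
  have hvr : v ≠ r := ne_of_mem_of_not_mem hv hr
  simpa only [rootCapacity_of_ne hvr] using h v hv

lemma rootedDom_iso (φ : G ≃g H) (r : V) (l : ℕ∞) :
    rootedDom H (φ r) l = rootedDom G r l := by
  have hcomp : rootDemand (φ r) l ∘ φ = rootDemand r l := by
    classical exact funext fun _ => if_congr φ.injective.eq_iff rfl rfl
  rw [rootedDom, rootedDom, ← fDomNumber_comp φ, hcomp]

lemma rootedInd_iso (φ : G ≃g H) (r : V) (c : ℕ) :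
    rootedInd H (φ r) c = rootedInd G r c := by
  have hcomp : rootCapacity (φ r) c ∘ φ = rootCapacity r c := by
    classical exact funext fun _ => if_congr φ.injective.eq_iff rfl rfl
  rw [rootedInd, rootedInd, ← fIndNumber_comp φ, hcomp]

lemma fDomNumber_two (G : SimpleGraph V) : fDomNumber G (fun _ => 2) = kDominationNumber G 2 := by
  have isFDominating_two (S : Set V) : IsFDominating G (fun _ => 2) S ↔ IsKDominating G 2 S :=
    forall₂_congr fun _ _ => Nat.cast_le (m := 2)
  simp only [fDomNumber, isFDominating_two, kDominationNumber]

lemma fIndNumber_two (G : SimpleGraph V) :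
    fIndNumber G (fun _ => 2) = kIndependenceNumber G 2 := rfl

lemma rootedDom_two (G : SimpleGraph V) (r : V) : rootedDom G r 2 = kDominationNumber G 2 := by
  have hconst : rootDemand r 2 = fun _ => 2 := funext fun _ => ite_self 2
  rw [rootedDom, hconst, fDomNumber_two]

lemma rootedInd_two (G : SimpleGraph V) (r : V) : rootedInd G r 2 = kIndependenceNumber G 2 := by
  have hconst : rootCapacity r 2 = fun _ => 2 := funext fun _ => ite_self 2
  rw [rootedInd, hconst, fIndNumber_two]

/-- `G` is balanced if its `2`-domination number and its `2`-independence number agree. -/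
def IsBalanced (G : SimpleGraph V) : Prop := kDominationNumber G 2 = kIndependenceNumber G 2

lemma isBalanced_congr (φ : G ≃g H) : IsBalanced G ↔ IsBalanced H := by
  rw [IsBalanced, IsBalanced, ← fDomNumber_two H, ← fDomNumber_comp φ, ← fIndNumber_two H,
    ← fIndNumber_comp φ, ← fDomNumber_two, ← fIndNumber_two]
  rfl

end Rooted

section Attach

variable {A Y : Type*} {a : SimpleGraph A} {r : A} {L : SimpleGraph Y} {N : Set Y}

/-- The disjoint union of the rooted graph `(a, r)` and of `L`, with the root `r` joined to the
vertices of `N`. It serves to separate a part `a` of a graph from its surroundings `L`. -/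
def attach (a : SimpleGraph A) (r : A) (L : SimpleGraph Y) (N : Set Y) : SimpleGraph (A ⊕ Y) where
  Adj
    | .inl x, .inl y => a.Adj x y
    | .inl x, .inr y => x = r ∧ y ∈ N
    | .inr y, .inl x => x = r ∧ y ∈ N
    | .inr x, .inr y => L.Adj x y
  symm := ⟨by
    rintro (x | x) (y | y) h
    exacts [a.adj_symm h, h, h, L.adj_symm h]⟩
  loopless := ⟨by
    rintro (x | x) h
    exacts [a.irrefl h, L.irrefl h]⟩

@[simp] lemma attach_inl_inl {x y : A} : (attach a r L N).Adj (.inl x) (.inl y) ↔ a.Adj x y :=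
  Iff.rfl

@[simp] lemma attach_inl_inr {x : A} {y : Y} :
    (attach a r L N).Adj (.inl x) (.inr y) ↔ x = r ∧ y ∈ N := Iff.rfl

@[simp] lemma attach_inr_inl {x : A} {y : Y} :
    (attach a r L N).Adj (.inr y) (.inl x) ↔ x = r ∧ y ∈ N := Iff.rfl

@[simp] lemma attach_inr_inr {x y : Y} : (attach a r L N).Adj (.inr x) (.inr y) ↔ L.Adj x y :=
  Iff.rfl

lemma exists_eq_image_inl_union_image_inr (U : Set (A ⊕ Y)) :
    ∃ (S : Set A) (T : Set Y), U = Sum.inl '' S ∪ Sum.inr '' T :=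
  ⟨Sum.inl ⁻¹' U, Sum.inr ⁻¹' U, (image_preimage_inl_union_image_preimage_inr U).symm⟩

lemma ncard_image_inl_union_image_inr [Finite A] [Finite Y] (S : Set A) (T : Set Y) :
    (Sum.inl '' S ∪ Sum.inr '' T : Set (A ⊕ Y)).ncard = S.ncard + T.ncard := by
  rw [ncard_union_eq (by simp [disjoint_left]), ncard_image_of_injective _ Sum.inl_injective,
    ncard_image_of_injective _ Sum.inr_injective]

open Classical in
/-- The demand left in `L` when each vertex of `N` has a further neighbour in the dominating set if
`P` holds. -/
noncomputable def residualDemand (N : Set Y) (P : Prop) (y : Y) : ℕ∞ :=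
  if y ∈ N ∧ P then 1 else 2

open Classical in
/-- The capacity left in `L` when each vertex of `N` has a further neighbour in the independent set
if `P` holds. -/
noncomputable def residualCapacity (N : Set Y) (P : Prop) (y : Y) : ℕ :=
  if y ∈ N ∧ P then 1 else 2

lemma residualDemand_anti (N : Set Y) : Antitone (residualDemand N) := fun P Q h y => by
  unfold residualDemand
  split_ifs with hQ hP hP
  exacts [le_rfl, one_le_two, (hQ ⟨hP.1, h hP.2⟩).elim, le_rfl]

lemma residualCapacity_anti (N : Set Y) : Antitone (residualCapacity N) := fun P Q h y => by
  unfold residualCapacity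
  split_ifs with hQ hP hP
  exacts [le_rfl, one_le_two, (hQ ⟨hP.1, h hP.2⟩).elim, le_rfl]

lemma residualDemand_singleton_true (s : Y) : residualDemand {s} True = rootDemand s 1 := by
  classical
  funext y
  simp only [residualDemand, rootDemand, mem_singleton_iff, and_true]

lemma residualDemand_false (N : Set Y) (s : Y) : residualDemand N False = rootDemand s 2 := by
  ext y
  simp [residualDemand, rootDemand]

lemma residualCapacity_singleton_true (s : Y) :
    residualCapacity {s} True = rootCapacity s 1 := by
  classical
  funext y
  simp only [residualCapacity, rootCapacity, mem_singleton_iff, and_true]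

lemma residualCapacity_false (N : Set Y) (s : Y) :
    residualCapacity N False = rootCapacity s 2 := by
  ext y
  simp [residualCapacity, rootCapacity]

lemma degIn_attach_inl (S : Set A) (T : Set Y) {x : A} (hx : x ≠ r) :
    degIn (attach a r L N) (Sum.inl '' S ∪ Sum.inr '' T) (.inl x) = degIn a S x := by
  rw [degIn, degIn, ← ncard_image_of_injective (a.neighborSet x ∩ S) (Sum.inl_injective (β := Y))]
  congr 1
  ext (y | y) <;> simp [hx]

variable [Finite A] [Finite Y]

lemma degIn_attach_root (S : Set A) (T : Set Y) :
    degIn (attach a r L N) (Sum.inl '' S ∪ Sum.inr '' T) (.inl r) =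
      degIn a S r + (N ∩ T).ncard := by
  rw [degIn, degIn, ← ncard_image_inl_union_image_inr]
  congr 1
  ext (x | x) <;> simp

open Classical in
lemma degIn_attach_inr (S : Set A) (T : Set Y) (y : Y) :
    degIn (attach a r L N) (Sum.inl '' S ∪ Sum.inr '' T) (.inr y) =
      (if y ∈ N ∧ r ∈ S then 1 else 0) + degIn L T y := by
  have hroot : (if y ∈ N ∧ r ∈ S then 1 else 0) = {x | x = r ∧ y ∈ N ∧ r ∈ S}.ncard := by
    split_ifs with h <;> simp [h]
  rw [degIn, degIn, hroot, ← ncard_image_inl_union_image_inr]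
  congr 1
  ext (x | x)
  · simp only [mem_inter_iff, SimpleGraph.mem_neighborSet, attach_inr_inl, mem_union, mem_image,
      Sum.inl.injEq, exists_eq_right, reduceCtorEq, and_false, exists_false, or_false,
      mem_ofPred_eq]
    constructor
    · rintro ⟨⟨rfl, hy⟩, hx⟩
      exact ⟨rfl, hy, hx⟩
    · rintro ⟨rfl, hy, hx⟩
      exact ⟨⟨rfl, hy⟩, hx⟩
  · simp

lemma isFDominating_attach_iff {l : ℕ∞} {S : Set A} {T : Set Y} :
    IsFDominating (attach a r L N) (rootDemand (Sum.inl r) l) (Sum.inl '' S ∪ Sum.inr '' T) ↔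
      IsFDominating a (rootDemand r (l - (N ∩ T).ncard)) S ∧
        IsFDominating L (residualDemand N (r ∈ S)) T := by
  have hinl (x : A) : rootDemand (Sum.inl r : A ⊕ Y) l (.inl x) ≤
        degIn (attach a r L N) (Sum.inl '' S ∪ Sum.inr '' T) (.inl x) ↔
      rootDemand r (l - (N ∩ T).ncard) x ≤ degIn a S x := by
    obtain rfl | hx := eq_or_ne x r
    · rw [rootDemand_self, rootDemand_self, degIn_attach_root, tsub_le_iff_right, Nat.cast_add]
    · rw [rootDemand_of_ne hx, rootDemand_of_ne (Sum.inl_injective.ne hx), degIn_attach_inl _ _ hx]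
  have hinr (y : Y) : rootDemand (Sum.inl r) l (.inr y) ≤
        degIn (attach a r L N) (Sum.inl '' S ∪ Sum.inr '' T) (.inr y) ↔
      residualDemand N (r ∈ S) y ≤ degIn L T y := by
    rw [rootDemand_of_ne Sum.inr_ne_inl, degIn_attach_inr, residualDemand]
    split_ifs <;> norm_cast <;> omega
  simp only [IsFDominating, Sum.forall, hinl, hinr, mem_union, mem_image, Sum.inl.injEq,
    Sum.inr.injEq, exists_eq_right, reduceCtorEq, and_false, exists_false, or_false, false_or]

lemma isFIndependent_attach_iff {c : ℕ} {S : Set A} {T : Set Y} :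
    IsFIndependent (attach a r L N) (rootCapacity (Sum.inl r) c) (Sum.inl '' S ∪ Sum.inr '' T) ↔
      IsFIndependent a (rootCapacity r (c - (N ∩ T).ncard)) S ∧
        IsFIndependent L (residualCapacity N (r ∈ S)) T := by
  have hinl (x : A) : degIn (attach a r L N) (Sum.inl '' S ∪ Sum.inr '' T) (.inl x) <
        rootCapacity (Sum.inl r : A ⊕ Y) c (.inl x) ↔
      degIn a S x < rootCapacity r (c - (N ∩ T).ncard) x := by
    obtain rfl | hx := eq_or_ne x r
    · rw [rootCapacity_self, rootCapacity_self, degIn_attach_root, lt_tsub_iff_right]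
    · rw [rootCapacity_of_ne hx, rootCapacity_of_ne (Sum.inl_injective.ne hx),
        degIn_attach_inl _ _ hx]
  have hinr (y : Y) : degIn (attach a r L N) (Sum.inl '' S ∪ Sum.inr '' T) (.inr y) <
        rootCapacity (Sum.inl r : A ⊕ Y) c (.inr y) ↔
      degIn L T y < residualCapacity N (r ∈ S) y := by
    rw [rootCapacity_of_ne Sum.inr_ne_inl, degIn_attach_inr, residualCapacity]
    split_ifs <;> omega
  simp [IsFIndependent, hinl, hinr]

/-! ### Substituting rooted graphs -/

section Substitute

variable {A' : Type*} [Finite A'] {a' : SimpleGraph A'} {r' : A'} {m n : ℕ}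

lemma kDominationNumber_attach_add_le
    (htop : rootedDom a' r' ⊤ + m ≤ rootedDom a r ⊤ + n)
    (h : ∀ l ≤ 2, rootedDom a' r' (l : ℕ) + m ≤ rootedDom a r (l : ℕ) + n)
    (L : SimpleGraph Y) (N : Set Y) :
    kDominationNumber (attach a' r' L N) 2 + m ≤ kDominationNumber (attach a r L N) 2 + n := by
  rw [← rootedDom_two _ (.inl r'), ← rootedDom_two _ (.inl r)]
  obtain ⟨U, hU, hcard⟩ := exists_ncard_eq_fDomNumber (attach a r L N) (rootDemand (Sum.inl r) 2)
  obtain ⟨S, T, rfl⟩ := exists_eq_image_inl_union_image_inr U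
  obtain ⟨hS, hT⟩ := isFDominating_attach_iff.1 hU
  rw [ncard_image_inl_union_image_inr] at hcard
  have replace_root (l : ℕ∞) (hl : 2 - ((N ∩ T).ncard : ℕ∞) ≤ l) (hr : r ∈ S → l = ⊤)
      (hSl : IsFDominating a (rootDemand r l) S)
      (hle : rootedDom a' r' l + m ≤ rootedDom a r l + n) :
      rootedDom (attach a' r' L N) (.inl r') 2 + m ≤ rootedDom (attach a r L N) (.inl r) 2 + n := by
    obtain ⟨X, hX, hXcard⟩ := exists_ncard_eq_fDomNumber a' (rootDemand r' l)
    have hroot (h : r ∈ S) : r' ∈ X := hX.mem_of_eq_top ((rootDemand_self r' l).trans (hr h))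
    have hUX := fDomNumber_le (isFDominating_attach_iff.2
      ⟨hX.mono (rootDemand_mono r' hl), hT.mono (residualDemand_anti N hroot)⟩)
    have hSle := fDomNumber_le hSl
    rw [ncard_image_inl_union_image_inr] at hUX
    unfold rootedDom at *
    omega
  by_cases hr : r ∈ S
  · exact replace_root ⊤ le_top (fun _ => rfl) (hS.of_root_mem hr) htop
  · refine replace_root (2 - (N ∩ T).ncard : ℕ) (by push_cast; rfl) (fun h => (hr h).elim) ?_
      (h _ (Nat.sub_le ..))
    push_cast
    exact hS

lemma kIndependenceNumber_attach_add_le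
    (h : ∀ c ≤ 2, rootedInd a r c + m ≤ rootedInd a' r' c + n)
    (L : SimpleGraph Y) (N : Set Y) :
    kIndependenceNumber (attach a r L N) 2 + m ≤ kIndependenceNumber (attach a' r' L N) 2 + n := by
  rw [← rootedInd_two _ (.inl r), ← rootedInd_two _ (.inl r')]
  obtain ⟨U, hU, hcard⟩ := exists_ncard_eq_fIndNumber (attach a r L N) (rootCapacity (Sum.inl r) 2)
  obtain ⟨S, T, rfl⟩ := exists_eq_image_inl_union_image_inr U
  obtain ⟨hS, hT⟩ := isFIndependent_attach_iff.1 hU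
  rw [ncard_image_inl_union_image_inr] at hcard
  have replace_root (c : ℕ) (hc : c ≤ 2 - (N ∩ T).ncard) (hr : r ∉ S → c = 0)
      (hSc : IsFIndependent a (rootCapacity r c) S) :
      rootedInd (attach a r L N) (.inl r) 2 + m ≤ rootedInd (attach a' r' L N) (.inl r') 2 + n := by
    obtain ⟨X, hX, hXcard⟩ := exists_ncard_eq_fIndNumber a' (rootCapacity r' c)
    have hroot (hX' : r' ∈ X) : r ∈ S := by
      by_contra h
      exact hX.notMem_of_eq_zero ((rootCapacity_self r' c).trans (hr h)) hX'
    have hUX := le_fIndNumber (isFIndependent_attach_iff.2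
      ⟨hX.mono (rootCapacity_mono r' hc), hT.mono (residualCapacity_anti N hroot)⟩)
    have hSle := le_fIndNumber hSc
    have hle := h c (by omega)
    rw [ncard_image_inl_union_image_inr] at hUX
    unfold rootedInd at *
    omega
  by_cases hr : r ∈ S
  · exact replace_root _ le_rfl (fun h => (h hr).elim) hS
  · exact replace_root 0 (Nat.zero_le _) (fun _ => rfl) (hS.of_root_notMem hr)

end Substitute

/-! ### Joining two rooted graphs -/

variable {B : Type*} [Finite B] (a : SimpleGraph A) (r : A) (b : SimpleGraph B) (s : B)

lemma rootedDom_attach_singleton (l : ℕ∞) : rootedDom (attach a r b {s}) (.inl r) l =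
    min (rootedDom a r ⊤ + rootedDom b s 1)
      (min (rootedDom a r l + rootedDom b s 2) (rootedDom a r (l - 1) + rootedDom b s ⊤)) := by
  apply le_antisymm
  · have le_add (l₁ l₂ : ℕ∞) (hle : ∀ S T, IsFDominating a (rootDemand r l₁) S →
        IsFDominating b (rootDemand s l₂) T → l - ({s} ∩ T).ncard ≤ l₁ ∧
          residualDemand {s} (r ∈ S) ≤ rootDemand s l₂) :
        rootedDom (attach a r b {s}) (.inl r) l ≤ rootedDom a r l₁ + rootedDom b s l₂ := by
      obtain ⟨S, hS, hScard⟩ := exists_ncard_eq_fDomNumber a (rootDemand r l₁)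
      obtain ⟨T, hT, hTcard⟩ := exists_ncard_eq_fDomNumber b (rootDemand s l₂)
      obtain ⟨hl₁, hl₂⟩ := hle S T hS hT
      rw [rootedDom, rootedDom, rootedDom, ← hScard, ← hTcard, ← ncard_image_inl_union_image_inr]
      exact fDomNumber_le
        (isFDominating_attach_iff.2 ⟨hS.mono (rootDemand_mono r hl₁), hT.mono hl₂⟩)
    have residual_le (P : Prop) : residualDemand {s} P ≤ rootDemand s 2 :=
      residualDemand_false {s} s ▸ residualDemand_anti {s} False.elim
    refine le_min (le_add _ _ fun S T hS _ => ⟨le_top, ?_⟩) (le_min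
      (le_add _ _ fun S T _ _ => ⟨tsub_le_self, residual_le _⟩)
      (le_add _ _ fun S T _ hT => ⟨?_, (residual_le _).trans (rootDemand_mono s le_top)⟩))
    · rw [eq_true (hS.mem_of_eq_top (rootDemand_self r ⊤)), residualDemand_singleton_true]
    · simp [singleton_inter_of_mem (hT.mem_of_eq_top (rootDemand_self s ⊤))]
  · obtain ⟨U, hU, hcard⟩ := exists_ncard_eq_fDomNumber (attach a r b {s}) (rootDemand (.inl r) l)
    obtain ⟨S, T, rfl⟩ := exists_eq_image_inl_union_image_inr U
    obtain ⟨hS, hT⟩ := isFDominating_attach_iff.1 hU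
    rw [ncard_image_inl_union_image_inr] at hcard
    change _ = rootedDom (attach a r b {s}) (.inl r) l at hcard
    rw [← hcard, min_le_iff, min_le_iff]
    by_cases hr : r ∈ S
    · rw [eq_true hr, residualDemand_singleton_true] at hT
      exact .inl (add_le_add (fDomNumber_le (hS.of_root_mem hr)) (fDomNumber_le hT))
    rw [eq_false hr, residualDemand_false {s} s] at hT
    refine .inr ?_
    by_cases hs : s ∈ T
    · rw [singleton_inter_of_mem hs, ncard_singleton] at hS
      exact .inr (add_le_add (fDomNumber_le hS) (fDomNumber_le (hT.of_root_mem hs)))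
    · rw [singleton_inter_eq_empty.2 hs, ncard_empty, Nat.cast_zero, tsub_zero] at hS
      exact .inl (add_le_add (fDomNumber_le hS) (fDomNumber_le hT))

lemma rootedInd_attach_singleton (c : ℕ) : rootedInd (attach a r b {s}) (.inl r) c =
    max (rootedInd a r 0 + rootedInd b s 2)
      (max (rootedInd a r c + rootedInd b s 0) (rootedInd a r (c - 1) + rootedInd b s 1)) := by
  apply le_antisymm
  · obtain ⟨U, hU, hcard⟩ :=
      exists_ncard_eq_fIndNumber (attach a r b {s}) (rootCapacity (.inl r) c)
    obtain ⟨S, T, rfl⟩ := exists_eq_image_inl_union_image_inr U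
    obtain ⟨hS, hT⟩ := isFIndependent_attach_iff.1 hU
    rw [ncard_image_inl_union_image_inr] at hcard
    rw [rootedInd, ← hcard, le_max_iff, le_max_iff]
    by_cases hr : r ∈ S
    · rw [eq_true hr, residualCapacity_singleton_true] at hT
      refine .inr ?_
      by_cases hs : s ∈ T
      · rw [singleton_inter_of_mem hs, ncard_singleton] at hS
        exact .inr (add_le_add (le_fIndNumber hS) (le_fIndNumber hT))
      · rw [singleton_inter_eq_empty.2 hs, ncard_empty, tsub_zero] at hS
        exact .inl (add_le_add (le_fIndNumber hS) (le_fIndNumber (hT.of_root_notMem hs)))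
    · rw [eq_false hr, residualCapacity_false {s} s] at hT
      exact .inl (add_le_add (le_fIndNumber (hS.of_root_notMem hr)) (le_fIndNumber hT))
  · have add_le (c₁ c₂ : ℕ) (hle : ∀ S T, IsFIndependent a (rootCapacity r c₁) S →
        IsFIndependent b (rootCapacity s c₂) T →
          IsFIndependent a (rootCapacity r (c - ({s} ∩ T).ncard)) S ∧
          rootCapacity s c₂ ≤ residualCapacity {s} (r ∈ S)) :
        rootedInd a r c₁ + rootedInd b s c₂ ≤ rootedInd (attach a r b {s}) (.inl r) c := by
      obtain ⟨S, hS, hScard⟩ := exists_ncard_eq_fIndNumber a (rootCapacity r c₁)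
      obtain ⟨T, hT, hTcard⟩ := exists_ncard_eq_fIndNumber b (rootCapacity s c₂)
      obtain ⟨hSc, hc₂⟩ := hle S T hS hT
      rw [rootedInd, rootedInd, rootedInd, ← hScard, ← hTcard, ← ncard_image_inl_union_image_inr]
      exact le_fIndNumber (isFIndependent_attach_iff.2 ⟨hSc, hT.mono hc₂⟩)
    have le_residual (P : Prop) : rootCapacity s 1 ≤ residualCapacity {s} P :=
      residualCapacity_singleton_true s ▸ residualCapacity_anti {s} fun _ => trivial
    have ncard_le (T : Set B) : ({s} ∩ T).ncard ≤ 1 :=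
      (ncard_inter_le_ncard_left {s} T).trans_eq (ncard_singleton s)
    refine max_le (add_le _ _ fun S T hS _ => ?_) (max_le (add_le _ _ fun S T hS hT => ?_)
      (add_le _ _ fun S T hS _ => ⟨hS.mono (rootCapacity_mono r ?_), le_residual _⟩))
    · have hr := hS.notMem_of_eq_zero (rootCapacity_self r 0)
      exact ⟨hS.of_root_notMem hr, by rw [eq_false hr, residualCapacity_false {s} s]⟩
    · have hs := hT.notMem_of_eq_zero (rootCapacity_self s 0)
      rw [singleton_inter_eq_empty.2 hs, ncard_empty, tsub_zero]
      exact ⟨hS, (rootCapacity_mono s zero_le_one).trans (le_residual _)⟩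
    · exact Nat.sub_le_sub_left (ncard_le T) c

end Attach

/-! ### Profiles -/

/-- The rooted domination numbers for the demands `0`, `1`, `2`, `⊤` at the root, and the rooted
independence numbers for the capacities `0`, `1`, `2` at the root. -/
structure Profile where
  (dom0 dom1 dom2 domTop ind0 ind1 ind2 : ℕ)
deriving DecidableEq

/-- The profile of the graph `G` with root `r`. -/
noncomputable def profile {V : Type*} (G : SimpleGraph V) (r : V) : Profile :=
  ⟨rootedDom G r 0, rootedDom G r 1, rootedDom G r 2, rootedDom G r ⊤,
    rootedInd G r 0, rootedInd G r 1, rootedInd G r 2⟩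

namespace Profile

/-- The profile of the rooted graph obtained by making the root of a graph with profile `y` a
neighbour of the root of a graph with profile `x`. -/
def join (x y : Profile) : Profile where
  dom0 := min (x.domTop + y.dom1) (min (x.dom0 + y.dom2) (x.dom0 + y.domTop))
  dom1 := min (x.domTop + y.dom1) (min (x.dom1 + y.dom2) (x.dom0 + y.domTop))
  dom2 := min (x.domTop + y.dom1) (min (x.dom2 + y.dom2) (x.dom1 + y.domTop))
  domTop := min (x.domTop + y.dom1) (min (x.domTop + y.dom2) (x.domTop + y.domTop))
  ind0 := max (x.ind0 + y.ind2) (max (x.ind0 + y.ind0) (x.ind0 + y.ind1))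
  ind1 := max (x.ind0 + y.ind2) (max (x.ind1 + y.ind0) (x.ind0 + y.ind1))
  ind2 := max (x.ind0 + y.ind2) (max (x.ind2 + y.ind0) (x.ind1 + y.ind1))

/-- All numbers of the profile `x`, increased by `k`. -/
def shift (x : Profile) (k : ℕ) : Profile :=
  ⟨x.dom0 + k, x.dom1 + k, x.dom2 + k, x.domTop + k, x.ind0 + k, x.ind1 + k, x.ind2 + k⟩

/-- A lower bound, valid for every graph that contains a rooted graph with profile `x` as a branch,
for the difference between the independence and the domination number. -/
def excess (x : Profile) : ℤ :=
  min (x.ind2 - x.dom2 : ℤ) (min (x.ind1 - x.dom1) (x.ind0 - x.dom0))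

/-- The order relations that hold between the numbers of the profile of a rooted tree. -/
structure Regular (x : Profile) : Prop where
  dom0_le_dom1 : x.dom0 ≤ x.dom1
  dom1_le_dom2 : x.dom1 ≤ x.dom2
  dom2_le_domTop : x.dom2 ≤ x.domTop
  domTop_le_dom0 : x.domTop ≤ x.dom0 + 1
  ind0_le_ind1 : x.ind0 ≤ x.ind1
  ind1_le_ind2 : x.ind1 ≤ x.ind2
  ind2_le_ind0 : x.ind2 ≤ x.ind0 + 1

lemma Regular.join {x y : Profile} (hx : x.Regular) (hy : y.Regular) : (x.join y).Regular := by
  obtain ⟨⟩ := hx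
  obtain ⟨⟩ := hy
  constructor <;> simp only [Profile.join] <;> omega

lemma excess_add_le {x y : Profile} (hx : x.Regular) (hy : y.Regular) :
    x.excess + y.excess ≤ (x.join y).excess := by
  have excess_le (z : Profile) : z.excess ≤ z.ind2 - z.dom2 ∧ z.excess ≤ z.ind1 - z.dom1 ∧
      z.excess ≤ z.ind0 - z.dom0 :=
    ⟨min_le_left _ _, (min_le_right _ _).trans (min_le_left _ _),
      (min_le_right _ _).trans (min_le_right _ _)⟩
  have hx_excess := excess_le x
  have hy_excess := excess_le y
  obtain ⟨⟩ := hx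
  obtain ⟨⟩ := hy
  generalize x.excess = k at hx_excess ⊢
  generalize y.excess = l at hy_excess ⊢
  refine le_min ?_ (le_min ?_ ?_) <;> simp only [join] <;> omega

end Profile

lemma profile_attach_singleton {A B : Type*} [Finite A] [Finite B] (a : SimpleGraph A) (r : A)
    (b : SimpleGraph B) (s : B) :
    profile (attach a r b {s}) (.inl r) = (profile a r).join (profile b s) := by
  have two_sub_one : (2 : ℕ∞) - 1 = 1 := rfl
  simp [profile, Profile.join, rootedDom_attach_singleton, rootedInd_attach_singleton, two_sub_one]

lemma isBalanced_iff_profile {V : Type*} {G : SimpleGraph V} (r : V) :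
    IsBalanced G ↔ (profile G r).dom2 = (profile G r).ind2 := by
  rw [IsBalanced, ← rootedDom_two G r, ← rootedInd_two G r]
  rfl

lemma isBalanced_attach_iff {A A' Y : Type*} [Finite A] [Finite A'] [Finite Y]
    {a : SimpleGraph A} {r : A} {a' : SimpleGraph A'} {r' : A'} {k : ℕ}
    (h : profile a' r' = (profile a r).shift k) (L : SimpleGraph Y) (N : Set Y) :
    IsBalanced (attach a' r' L N) ↔ IsBalanced (attach a r L N) := by
  simp only [profile, Profile.shift, Profile.mk.injEq] at h
  obtain ⟨h₀, h₁, h₂, htop, g₀, g₁, g₂⟩ := h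
  have hdom : ∀ l ≤ 2, rootedDom a' r' (l : ℕ) = rootedDom a r (l : ℕ) + k := by
    intro l hl
    interval_cases l
    exacts [h₀, h₁, h₂]
  have hind : ∀ c ≤ 2, rootedInd a' r' c = rootedInd a r c + k := by
    intro c hc
    interval_cases c
    exacts [g₀, g₁, g₂]
  have dom_le := kDominationNumber_attach_add_le (m := 0) (n := k) htop.le
    (fun l hl => (hdom l hl).le) L N
  have le_dom := kDominationNumber_attach_add_le (m := k) (n := 0) htop.ge
    (fun l hl => (hdom l hl).ge) L N
  have ind_le := kIndependenceNumber_attach_add_le (m := 0) (n := k)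
    (fun c hc => (hind c hc).le) L N
  have le_ind := kIndependenceNumber_attach_add_le (m := k) (n := 0)
    (fun c hc => (hind c hc).ge) L N
  unfold IsBalanced
  omega

lemma profile_bot_unit : profile (⊥ : SimpleGraph Unit) () = ⟨0, 1, 1, 1, 0, 1, 1⟩ := by
  have degIn_bot (S : Set Unit) (v : Unit) : degIn ⊥ S v = 0 := by
    simp [degIn, SimpleGraph.neighborSet]
  have ncard_le_one (S : Set Unit) : S.ncard ≤ 1 := (ncard_le_card S).trans_eq Nat.card_unique
  have dom_zero : rootedDom (⊥ : SimpleGraph Unit) () 0 = 0 := by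
    refine Nat.le_zero.1 ((fDomNumber_le (S := ∅) fun v _ => ?_).trans_eq (ncard_empty _))
    simp [rootDemand_self]
  have dom_of_pos (l : ℕ∞) (hl : 0 < l) : rootedDom (⊥ : SimpleGraph Unit) () l = 1 := by
    obtain ⟨S, hS, hcard⟩ := exists_ncard_eq_fDomNumber ⊥ (rootDemand () l)
    have hmem : () ∈ S := by
      by_contra h
      have hle := hS () h
      rw [rootDemand_self, degIn_bot] at hle
      exact hl.not_ge hle
    exact hcard.symm.trans ((ncard_le_one S).antisymm ((ncard_pos S.toFinite).2 ⟨(), hmem⟩))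
  have ind_zero : rootedInd (⊥ : SimpleGraph Unit) () 0 = 0 := by
    obtain ⟨S, hS, hcard⟩ := exists_ncard_eq_fIndNumber ⊥ (rootCapacity () 0)
    have hS' : S = ∅ := eq_empty_of_forall_notMem fun _ =>
      hS.notMem_of_eq_zero (rootCapacity_self () 0)
    rw [rootedInd, ← hcard, hS', ncard_empty]
  have ind_of_pos (c : ℕ) (hc : 0 < c) : rootedInd (⊥ : SimpleGraph Unit) () c = 1 := by
    obtain ⟨S, -, hcard⟩ := exists_ncard_eq_fIndNumber ⊥ (rootCapacity () c)
    refine (hcard.symm.trans_le (ncard_le_one S)).antisymm ?_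
    rw [← ncard_singleton ()]
    refine le_fIndNumber fun v _ => ?_
    rwa [degIn_bot, rootCapacity_self]
  simp [profile, dom_zero, dom_of_pos, ind_zero, ind_of_pos]

/-! ### Isomorphisms of rooted graphs -/

section Iso

variable {A A' B C Y Y' : Type*} {a : SimpleGraph A} {a' : SimpleGraph A'} {r : A} {r' : A'}
  {L : SimpleGraph Y} {L' : SimpleGraph Y'}

/-- Attachment respects isomorphisms. -/
def attachCongr (φ : a ≃g a') (hφ : φ r = r') (ψ : L ≃g L') {N : Set Y} {N' : Set Y'}
    (hψ : ∀ y, ψ y ∈ N' ↔ y ∈ N) : attach a r L N ≃g attach a' r' L' N' where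
  toEquiv := Equiv.sumCongr φ.toEquiv ψ.toEquiv
  map_rel_iff' := by
    subst hφ
    rintro (x | x) (y | y) <;> simp [φ.map_adj_iff, ψ.map_adj_iff, hψ]

/-- A graph attached at the root of an attachment can be moved to the surroundings. -/
def attachAssocRoot (a : SimpleGraph A) (r : A) (L : SimpleGraph Y) (N : Set Y)
    (b : SimpleGraph B) (M : Set B) : attach (attach a r L N) (.inl r) b M ≃g
      attach a r (L ⊕g b) (Sum.inl '' N ∪ Sum.inr '' M) where
  toEquiv := Equiv.sumAssoc _ _ _
  map_rel_iff' := by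
    rintro ((x | x) | x) ((y | y) | y) <;> simp

/-- A graph attached to the surroundings can be moved to the surroundings. -/
def attachAssocRight (a : SimpleGraph A) (r : A) (L : SimpleGraph Y) (N : Set Y) (y : Y)
    (b : SimpleGraph B) (M : Set B) :
    attach (attach a r L N) (.inr y) b M ≃g attach a r (attach L y b M) (Sum.inl '' N) where
  toEquiv := Equiv.sumAssoc _ _ _
  map_rel_iff' := by
    rintro ((x | x) | x) ((y | y) | y) <;> simp

/-- The two sides of an edge that joins two rooted graphs can be exchanged. -/
def attachComm (a : SimpleGraph A) (r : A) (b : SimpleGraph B) (s : B) :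
    attach a r b {s} ≃g attach b s a {r} where
  toEquiv := Equiv.sumComm _ _
  map_rel_iff' := by
    rintro (x | x) (y | y) <;> simp [and_comm]

/-- Two graphs can be attached in either order. -/
def attachSwap (a : SimpleGraph A) (r v : A) (b : SimpleGraph B) (M : Set B) (c : SimpleGraph C)
    (N : Set C) :
    attach (attach a r b M) (.inl v) c N ≃g attach (attach a v c N) (.inl r) b M where
  toEquiv := (Equiv.sumAssoc _ _ _).trans
    (((Equiv.refl _).sumCongr (Equiv.sumComm _ _)).trans (Equiv.sumAssoc _ _ _).symm)
  map_rel_iff' := by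
    rintro ((x | x) | x) ((y | y) | y) <;> simp

/-- The attachment with empty surroundings. -/
def attachEmpty (a : SimpleGraph A) (r : A) : a ≃g attach a r (⊥ : SimpleGraph Empty) ∅ where
  toEquiv := (Equiv.sumEmpty A Empty).symm
  map_rel_iff' := by simp

lemma attach_singleton_eq (a : SimpleGraph A) (r : A) (b : SimpleGraph B) (s : B) :
    attach a r b {s} = (a ⊕g b) ⊔ SimpleGraph.edge (.inl r) (.inr s) := by
  ext (x | x) (y | y) <;> simp [SimpleGraph.edge_adj, and_comm]

/-- The rooted graphs `(G, r)` and `(H, s)` are isomorphic. -/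
def RootedIso {V W : Type*} (G : SimpleGraph V) (r : V) (H : SimpleGraph W) (s : W) : Prop :=
  ∃ φ : G ≃g H, φ r = s

namespace RootedIso

variable {V W X : Type*} {G : SimpleGraph V} {H : SimpleGraph W} {K : SimpleGraph X} {v : V}
  {w : W} {x : X}

lemma refl (G : SimpleGraph V) (v : V) : RootedIso G v G v := ⟨SimpleGraph.Iso.refl, rfl⟩

lemma symm : RootedIso G v H w → RootedIso H w G v := fun ⟨φ, h⟩ => ⟨φ.symm, by simp [← h]⟩

lemma trans : RootedIso G v H w → RootedIso H w K x → RootedIso G v K x :=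
  fun ⟨φ, h⟩ ⟨ψ, h'⟩ => ⟨φ.trans ψ, by simp [h, h']⟩

lemma nonempty_iso : RootedIso G v H w → Nonempty (G ≃g H) := fun ⟨φ, _⟩ => ⟨φ⟩

lemma profile_eq : RootedIso G v H w → profile G v = profile H w := fun ⟨φ, h⟩ => by
  simp only [profile, ← h, rootedDom_iso, rootedInd_iso]

lemma attach_inl {y : Y} {y' : Y'} :
    RootedIso a r a' r' → RootedIso L y L' y' →
      RootedIso (attach a r L {y}) (.inl r) (attach a' r' L' {y'}) (.inl r') :=
  fun ⟨φ, h⟩ ⟨ψ, h'⟩ => ⟨attachCongr φ h ψ (by simp [← h']), congrArg Sum.inl h⟩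

lemma attach_inr {y : Y} {y' : Y'} :
    RootedIso a r a' r' → RootedIso L y L' y' →
      RootedIso (attach a r L {y}) (.inr y) (attach a' r' L' {y'}) (.inr y') :=
  fun ⟨φ, h⟩ ⟨ψ, h'⟩ => ⟨attachCongr φ h ψ (by simp [← h']), congrArg Sum.inr h'⟩

end RootedIso

end Iso

/-! ### Rooted trees -/

/-- Rooted trees: `join a b` arises from `a` by making the root of `b` a child of its root. -/
inductive RTree
  | leaf : RTree
  | join : RTree → RTree → RTree
deriving DecidableEq

namespace RTree

/-- The vertex type of a rooted tree. -/
def Vert : RTree → Type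
  | leaf => Unit
  | join a b => a.Vert ⊕ b.Vert

/-- The root of a rooted tree. -/
def root : (t : RTree) → t.Vert
  | leaf => ()
  | join a _ => Sum.inl a.root

/-- The underlying graph of a rooted tree. -/
def graph : (t : RTree) → SimpleGraph t.Vert
  | leaf => ⊥
  | join a b => attach a.graph a.root b.graph {b.root}

/-- The number of vertices of a rooted tree. -/
def size : RTree → ℕ
  | leaf => 1
  | join a b => a.size + b.size

/-- The profile of a rooted tree, computed by recursion. -/
def eval : RTree → Profile
  | leaf => ⟨0, 1, 1, 1, 0, 1, 1⟩
  | join a b => a.eval.join b.eval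

instance finite_vert : (t : RTree) → Finite t.Vert
  | leaf => inferInstanceAs (Finite Unit)
  | join a b =>
    have := finite_vert a
    have := finite_vert b
    inferInstanceAs (Finite (a.Vert ⊕ b.Vert))

lemma card_vert : (t : RTree) → Nat.card t.Vert = t.size
  | leaf => Nat.card_unique (α := Unit)
  | join a b => by
    rw [size, ← card_vert a, ← card_vert b]
    exact Nat.card_sum

lemma profile_eq_eval : (t : RTree) → profile t.graph t.root = t.eval
  | leaf => profile_bot_unit
  | join a b => by
    rw [eval, ← profile_eq_eval a, ← profile_eq_eval b]
    exact profile_attach_singleton a.graph a.root b.graph b.root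

lemma isBalanced_graph_iff (t : RTree) : IsBalanced t.graph ↔ t.eval.dom2 = t.eval.ind2 := by
  rw [isBalanced_iff_profile t.root, profile_eq_eval]

lemma regular_eval : (t : RTree) → t.eval.Regular
  | leaf => by constructor <;> simp [eval]
  | join a b => (regular_eval a).join (regular_eval b)

lemma excess_add_excess_le (a b : RTree) :
    a.eval.excess + b.eval.excess ≤ (join a b).eval.excess :=
  Profile.excess_add_le (regular_eval a) (regular_eval b)

lemma excess_nonneg : (t : RTree) → 0 ≤ t.eval.excess
  | leaf => by decide
  | join a b => (add_nonneg (excess_nonneg a) (excess_nonneg b)).trans (excess_add_excess_le a b)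

/-- Two rooted trees are isomorphic. -/
def Iso (s t : RTree) : Prop := RootedIso s.graph s.root t.graph t.root

namespace Iso

variable {s t s' t' : RTree}

lemma refl (t : RTree) : Iso t t := RootedIso.refl _ _

lemma trans (h : Iso s t) (h' : Iso t t') : Iso s t' := RootedIso.trans h h'

lemma eval_eq (h : Iso s t) : s.eval = t.eval := by
  rw [← profile_eq_eval, ← profile_eq_eval, RootedIso.profile_eq h]

lemma size_eq (h : Iso s t) : s.size = t.size := by
  obtain ⟨φ⟩ := RootedIso.nonempty_iso h
  rw [← card_vert, ← card_vert, Nat.card_congr φ.toEquiv]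

lemma join (h : Iso s s') (h' : Iso t t') : Iso (s.join t) (s'.join t') :=
  RootedIso.attach_inl h h'

lemma join_right_comm (a b c : RTree) : Iso ((a.join b).join c) ((a.join c).join b) :=
  ⟨attachSwap a.graph a.root a.root b.graph {b.root} c.graph {c.root}, rfl⟩

end Iso

/-- The branches at the root of a rooted tree. -/
def children : RTree → List RTree
  | leaf => []
  | join a b => b :: a.children

/-- The rooted tree with the given branches at its root. -/
def ofList : List RTree → RTree
  | [] => leaf
  | b :: l => join (ofList l) b

lemma ofList_children : (t : RTree) → ofList t.children = t
  | leaf => rfl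
  | join a b => by rw [children, ofList, ofList_children a]

lemma Iso.ofList_of_perm {l l' : List RTree} (h : l.Perm l') : Iso (ofList l) (ofList l') := by
  induction h with
  | nil => exact .refl _
  | cons x _ ih => exact ih.join (.refl x)
  | swap x y l => exact join_right_comm _ _ _
  | trans _ _ ih₁ ih₂ => exact ih₁.trans ih₂

lemma Iso.of_children_perm {s t : RTree} (h : s.children.Perm t.children) : Iso s t := by
  rw [← ofList_children s, ← ofList_children t]
  exact .ofList_of_perm h

/-- Rooted trees with a hole in place of a branch. -/
inductive Context
  | hole : Context
  | left : Context → RTree → Context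
  | right : RTree → Context → Context

namespace Context

/-- The rooted tree that arises by filling the hole of a context. -/
def plug : Context → RTree → RTree
  | hole, t => t
  | left C b, t => (C.plug t).join b
  | right a C, t => a.join (C.plug t)

lemma exists_rootedIso_attach (C : Context) : ∃ (Y : Type) (_ : Finite Y) (L : SimpleGraph Y)
    (N : Set Y), (∀ s : RTree, RootedIso (C.plug s).graph (C.plug s).root
        (attach s.graph s.root L N) (.inl s.root)) ∨
      ∃ y, ∀ s : RTree, RootedIso (C.plug s).graph (C.plug s).root
        (attach s.graph s.root L N) (.inr y) := by
  induction C with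
  | hole => exact ⟨Empty, inferInstance, ⊥, ∅, .inl fun s => ⟨attachEmpty _ _, rfl⟩⟩
  | left C b ih =>
    obtain ⟨Y, _, L, N, h | ⟨y, h⟩⟩ := ih
    · exact ⟨Y ⊕ b.Vert, inferInstance, _, _, .inl fun s =>
        ((h s).attach_inl (.refl _ _)).trans ⟨attachAssocRoot _ _ _ _ _ _, rfl⟩⟩
    · exact ⟨Y ⊕ b.Vert, inferInstance, _, _, .inr ⟨.inl y, fun s =>
        ((h s).attach_inl (.refl _ _)).trans ⟨attachAssocRight _ _ _ _ _ _ _, rfl⟩⟩⟩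
  | right a C ih =>
    have exchange (s : RTree) : RootedIso (a.join (C.plug s)).graph (a.join (C.plug s)).root
      (attach (C.plug s).graph (C.plug s).root a.graph {a.root}) (.inr a.root) :=
      ⟨attachComm _ _ _ _, rfl⟩
    obtain ⟨Y, _, L, N, h | ⟨y, h⟩⟩ := ih
    · exact ⟨Y ⊕ a.Vert, inferInstance, _, _, .inr ⟨.inr a.root, fun s => (exchange s).trans
        (((h s).attach_inr (.refl _ _)).trans ⟨attachAssocRoot _ _ _ _ _ _, rfl⟩)⟩⟩
    · exact ⟨Y ⊕ a.Vert, inferInstance, _, _, .inr ⟨.inr a.root, fun s => (exchange s).trans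
        (((h s).attach_inr (.refl _ _)).trans ⟨attachAssocRight _ _ _ _ _ _ _, rfl⟩)⟩⟩

lemma exists_iso_attach (C : Context) : ∃ (Y : Type) (_ : Finite Y) (L : SimpleGraph Y)
    (N : Set Y), ∀ s : RTree, Nonempty ((C.plug s).graph ≃g attach s.graph s.root L N) := by
  obtain ⟨Y, hY, L, N, h | ⟨y, h⟩⟩ := C.exists_rootedIso_attach
  exacts [⟨Y, hY, L, N, fun s => (h s).nonempty_iso⟩, ⟨Y, hY, L, N, fun s => (h s).nonempty_iso⟩]

/-- The context whose hole is the tree with fewer branches at the root. -/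
def ofBranches : List RTree → Context
  | [] => hole
  | b :: l => left (ofBranches l) b

lemma children_plug_ofBranches (l : List RTree) (t : RTree) :
    ((ofBranches l).plug t).children = l ++ t.children := by
  induction l with
  | nil => rfl
  | cons b l ih => rw [ofBranches, plug, children, ih, List.cons_append]

end Context

lemma exists_iso_plug_of_subperm {s t : RTree} (h : s.children.Subperm t.children) :
    ∃ C : Context, Iso t (C.plug s) := by
  obtain ⟨l₀, hl₀, hsub⟩ := h
  obtain ⟨l, hl⟩ := hsub.exists_perm_append
  refine ⟨.ofBranches l, .of_children_perm ?_⟩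
  rw [Context.children_plug_ofBranches]
  exact hl.trans ((hl₀.append_right l).trans List.perm_append_comm)

end RTree

/-! ### Surgeries at an induced special tree -/

/-- An operation at a copy of the special tree `S`: the edges in `removed` are removed, and `k` new
vertices and the edges in `added` are added. -/
structure Surgery where
  S : SpecialTree
  k : ℕ
  removed : Finset (Sym2 (Fin S.order))
  added : Finset (Sym2 (Fin S.order ⊕ Fin k))

lemma mk_mem_image_map {A B : Type*} {g : A → B} {E : Set (Sym2 A)} {a b : B} :
    s(a, b) ∈ Sym2.map g '' E ↔ ∃ x y, s(x, y) ∈ E ∧ g x = a ∧ g y = b := by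
  constructor
  · rintro ⟨e, he, hab⟩
    induction e with | _ x y
    obtain ⟨h, h'⟩ | ⟨h, h'⟩ := Sym2.eq_iff.1 hab
    exacts [⟨x, y, he, h, h'⟩, ⟨y, x, Sym2.eq_swap ▸ he, h', h⟩]
  · rintro ⟨x, y, he, rfl, rfl⟩
    exact ⟨_, he, rfl⟩

lemma IsPDI.adj_iff {V : Type*} [Finite V] {S : SpecialTree} {G : SimpleGraph V}
    {e : S.graph ↪g G} (h : IsPDI S G e) {x : Fin S.order} {v : V} (hv : v ∉ range e) :
    G.Adj (e x) v ↔ x = S.white ∧ G.Adj (e S.white) v := by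
  refine ⟨fun hxv => ?_, fun ⟨hx, hv⟩ => hx ▸ hv⟩
  suffices x = S.white from ⟨this, this ▸ hxv⟩
  by_contra hx
  have hsub : e '' S.graph.neighborSet x ⊆ G.neighborSet (e x) := by
    rintro _ ⟨z, hz, rfl⟩
    exact e.map_adj_iff.2 hz
  have heq := eq_of_subset_of_ncard_le hsub (by rw [ncard_image_of_injective _ e.injective, h x hx])
  obtain ⟨z, -, rfl⟩ := heq.symm ▸ (show v ∈ G.neighborSet (e x) from hxv)
  exact hv ⟨z, rfl⟩

lemma IsPDI.exists_iso_attach {V : Type u} [Finite V] {S : SpecialTree} {G : SimpleGraph V}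
    {e : S.graph ↪g G} (h : IsPDI S G e) : ∃ (Y : Type u) (_ : Finite Y) (L : SimpleGraph Y)
      (N : Set Y) (φ : attach S.graph S.white L N ≃g G), φ ∘ Sum.inl = e := by
  have hbij : Bijective (Sum.elim e (Subtype.val : {v // v ∉ range e} → V)) := by
    refine ⟨e.injective.sumElim Subtype.val_injective fun x v hxv => v.2 ⟨x, hxv⟩, fun v => ?_⟩
    by_cases hv : v ∈ range e
    · exact hv.imp' Sum.inl fun _ => id
    · exact ⟨.inr ⟨v, hv⟩, rfl⟩
  refine ⟨{v // v ∉ range e}, inferInstance, G.comap Subtype.val, {v | G.Adj (e S.white) v},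
    ⟨Equiv.ofBijective _ hbij, ?_⟩, rfl⟩
  rintro (x | x) (y | y)
  exacts [e.map_adj_iff, h.adj_iff y.2, (G.adj_comm _ _).trans (h.adj_iff x.2), Iff.rfl]

lemma isPDI_attach {V Y : Type*} {S : SpecialTree} {G : SimpleGraph V} {L : SimpleGraph Y}
    {N : Set Y} (φ : attach S.graph S.white L N ≃g G) (e : S.graph ↪g G)
    (he : ∀ x, e x = φ (.inl x)) : IsPDI S G e := by
  intro x hx
  rw [← ncard_image_of_injective _ e.injective]
  congr 1
  ext v
  obtain ⟨y | y, rfl⟩ := φ.surjective v <;> simp [he, φ.map_adj_iff, hx]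

lemma nonempty_iso_iff_exists_newVertices {V W : Type u} {G : SimpleGraph W} {k : ℕ}
    {K : SimpleGraph (V ⊕ Fin k)} : Nonempty (G ≃g K) ↔
      ∃ (f : V ↪ W) (u : Fin k → W), NewVertices f (List.ofFn u) ∧ G = K.map (Sum.elim f u) := by
  simp only [NewVertices, List.nodup_ofFn, List.mem_ofFn']
  constructor
  · rintro ⟨φ⟩
    refine ⟨⟨φ.symm ∘ Sum.inl, φ.symm.injective.comp Sum.inl_injective⟩, φ.symm ∘ Sum.inr,
      ⟨φ.symm.injective.comp Sum.inr_injective, fun w => ?_⟩, ?_⟩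
    · obtain ⟨v | i, rfl⟩ := φ.symm.surjective w <;> simp
    · have hmap : G = K.map φ.toEquiv.symm.toEmbedding := by
        rw [SimpleGraph.map_symm]
        ext
        exact φ.map_adj_iff.symm
      refine hmap.trans (congrArg (fun g => SimpleGraph.map g K) ?_)
      ext (v | i) <;> rfl
  · rintro ⟨f, u, ⟨hu, huf⟩, rfl⟩
    have hbij : Bijective (Sum.elim f u) := by
      refine ⟨f.injective.sumElim hu fun v i hvi => (huf _).1 ⟨i, rfl⟩ ⟨v, hvi⟩, fun w => ?_⟩
      by_cases hw : w ∈ range f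
      · exact hw.imp' Sum.inl fun _ => id
      · exact ((huf w).2 hw).imp' Sum.inr fun _ => id
    exact ⟨(SimpleGraph.Iso.map (Equiv.ofBijective _ hbij) K).symm⟩

lemma map_sup_eq {X Z : Type*} (g : X → Z) (G H : SimpleGraph X) :
    (G ⊔ H).map g = G.map g ⊔ H.map g := by
  ext x y
  simp only [SimpleGraph.map_adj', SimpleGraph.sup_adj, or_and_right, exists_or, and_or_left]

lemma map_fromEdgeSet {X Z : Type*} (g : X → Z) (E : Set (Sym2 X)) :
    (SimpleGraph.fromEdgeSet E).map g = SimpleGraph.fromEdgeSet (Sym2.map g '' E) := by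
  ext x y
  simp only [SimpleGraph.map_adj', SimpleGraph.fromEdgeSet_adj, mk_mem_image_map,
    and_comm (b := x ≠ y)]
  refine and_congr_right fun hxy => exists₂_congr fun a b => ?_
  constructor
  · rintro ⟨⟨hab, -⟩, h⟩
    exact ⟨hab, h⟩
  · rintro ⟨hab, rfl, rfl⟩
    exact ⟨⟨hab, fun h => hxy (congrArg g h)⟩, rfl, rfl⟩

lemma map_sum_bot {X Z I : Type*} (g : X ⊕ I → Z) (G : SimpleGraph X) :
    (G ⊕g (⊥ : SimpleGraph I)).map g = G.map (g ∘ Sum.inl) := by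
  ext x y
  simp [SimpleGraph.map_adj', Sum.exists]

namespace Surgery

variable (d : Surgery) {V W Y : Type*}

/-- The result of a surgery on `G` at the copy `e` of the special tree. -/
def apply (G : SimpleGraph V) (e : Fin d.S.order → V) : SimpleGraph (V ⊕ Fin d.k) :=
  (G.deleteEdges (Sym2.map e '' d.removed) ⊕g ⊥) ⊔
    SimpleGraph.fromEdgeSet (Sym2.map (Sum.map e id) '' d.added)

/-- The result of a surgery on the special tree itself. -/
def after : SimpleGraph (Fin d.S.order ⊕ Fin d.k) := d.apply d.S.graph id

/-- `G` arises from `G'` by the surgery `d` at some PDI-subtree. -/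
def Rel (G' : SimpleGraph V) (G : SimpleGraph W) : Prop :=
  ∃ e : d.S.graph ↪g G', IsPDI d.S G' e ∧ Nonempty (G ≃g d.apply G' e)

variable {d}

/-- Surgery respects isomorphisms. -/
def applyCongr {G : SimpleGraph V} {H : SimpleGraph W} (φ : G ≃g H) (e : Fin d.S.order → V) :
    d.apply G e ≃g d.apply H (φ ∘ e) where
  toEquiv := Equiv.sumCongr φ.toEquiv (Equiv.refl _)
  map_rel_iff' := by
    rintro (x | x) (y | y) <;>
      simp [apply, mk_mem_image_map, Sum.exists, φ.map_adj_iff, -mem_image]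

/-- Surgery leaves the surroundings of the special tree alone. -/
def applyAttach (L : SimpleGraph Y) (N : Set Y) :
    d.apply (attach d.S.graph d.S.white L N) Sum.inl ≃g attach d.after (.inl d.S.white) L N where
  toEquiv := (Equiv.sumAssoc _ _ _).trans
    (((Equiv.refl _).sumCongr (Equiv.sumComm _ _)).trans (Equiv.sumAssoc _ _ _).symm)
  map_rel_iff' := by
    rintro ((x | x) | x) ((y | y) | y) <;>
      simp [apply, after, mk_mem_image_map, Sum.exists, -mem_image]

lemma Rel.exists_iso_attach {V W : Type u} [Finite V] {G' : SimpleGraph V} {G : SimpleGraph W}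
    (h : d.Rel G' G) : ∃ (Y : Type u) (_ : Finite Y) (L : SimpleGraph Y) (N : Set Y),
      Nonempty (G' ≃g attach d.S.graph d.S.white L N) ∧
      Nonempty (G ≃g attach d.after (.inl d.S.white) L N) := by
  obtain ⟨e, he, ⟨ψ⟩⟩ := h
  obtain ⟨Y, hY, L, N, φ, hφ⟩ := he.exists_iso_attach
  rw [← hφ] at ψ
  exact ⟨Y, hY, L, N, ⟨φ.symm⟩, ⟨ψ.trans ((applyCongr φ Sum.inl).symm.trans (applyAttach L N))⟩⟩

lemma Rel.of_iso_attach {G' : SimpleGraph V} {G : SimpleGraph W} {L : SimpleGraph Y} {N : Set Y}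
    (φ : attach d.S.graph d.S.white L N ≃g G') (ψ : G ≃g attach d.after (.inl d.S.white) L N) :
    d.Rel G' G :=
  ⟨⟨⟨fun x => φ (.inl x), φ.injective.comp Sum.inl_injective⟩, φ.map_adj_iff⟩,
    isPDI_attach φ _ fun _ => rfl,
    ⟨ψ.trans ((applyAttach L N).symm.trans (applyCongr φ Sum.inl))⟩⟩

end Surgery

section Operations

/-- Adding a vertex. -/
def Surgery.addVertex (S : SpecialTree) : Surgery := ⟨S, 1, ∅, {s(.inl S.v, .inr 0)}⟩

/-- Adding a path with one edge. -/
def Surgery.addEdge (S : SpecialTree) : Surgery :=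
  ⟨S, 2, ∅, {s(.inr 0, .inr 1), s(.inl S.v, .inr 0)}⟩

/-- Adding a path with two edges, attached by its centre. -/
def Surgery.addCherry (S : SpecialTree) : Surgery :=
  ⟨S, 3, ∅, {s(.inr 0, .inr 1), s(.inr 1, .inr 2), s(.inl S.v, .inr 1)}⟩

/-- Adding a path with two edges, attached by an end. -/
def Surgery.addPath (S : SpecialTree) : Surgery :=
  ⟨S, 3, ∅, {s(.inr 0, .inr 1), s(.inr 1, .inr 2), s(.inl S.v, .inr 0)}⟩

/-- Adding an edge at one end of `T₆` and a vertex at the other end. -/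
def Surgery.addBoth : Surgery :=
  ⟨T₆, 3, ∅, {s(.inr 0, .inr 2), s(.inl T₆v₁, .inr 0), s(.inl T₆v₂, .inr 1)}⟩

/-- Inserting a path into the edge `v₁v₂` of `T₁₄`. -/
def Surgery.insertPath : Surgery :=
  ⟨T₁₄, 3, {s(T₁₄v₁, T₁₄v₂)}, {s(.inr 0, .inr 1), s(.inr 1, .inr 2), s(.inl T₁₄v₁, .inr 0),
    s(.inl T₁₄v₂, .inr 1)}⟩

/-- The one-vertex tree, which is a PDI-subtree at every vertex. -/
def point : SpecialTree := ⟨1, edgeGraph 1 [], 0, 0⟩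

variable {V W : Type u} {G' : SimpleGraph V} {G : SimpleGraph W}

lemma Surgery.rel_mk_iff {S : SpecialTree} {k : ℕ} {removed : Finset (Sym2 (Fin S.order))}
    {added : Finset (Sym2 (Fin S.order ⊕ Fin k))} :
    (⟨S, k, removed, added⟩ : Surgery).Rel G' G ↔ ∃ e : S.graph ↪g G', IsPDI S G' e ∧
      ∃ (f : V ↪ W) (u : Fin k → W), NewVertices f (List.ofFn u) ∧
        G = (G'.deleteEdges (Sym2.map e '' removed)).map f ⊔
          SimpleGraph.fromEdgeSet (Sym2.map (Sum.elim (f ∘ e) u) '' added) := by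
  refine exists_congr fun e => and_congr_right fun _ =>
    nonempty_iso_iff_exists_newVertices.trans ?_
  simp only [apply, map_sup_eq, map_fromEdgeSet, map_sum_bot, Sum.elim_comp_inl, image_image,
    Sym2.map_map, Sum.elim_comp_map, comp_id]

attribute [local simp] Surgery.rel_mk_iff Fin.exists_fin_succ_pi Fin.exists_fin_zero_pi
  image_insert_eq IsAttacher

lemma cons_cons_cons_two {X : Type*} (a b c : X) (u : Fin 0 → X) :
    (Fin.cons a (Fin.cons b (Fin.cons c u : Fin 1 → X) : Fin 2 → X) : Fin 3 → X) 2 = c := rfl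

lemma op₁_iff :
    Op₁ G' G ↔ ∃ S ∈ ({T₁, T₂, T₈} : Set SpecialTree), (Surgery.addVertex S).Rel G' G := by
  simp [Op₁, Surgery.addVertex]

lemma op₂_iff : Op₂ G' G ↔
    ∃ S ∈ ({T₄, T₁₁, T₁₂, T₁₃, T₁₅} : Set SpecialTree), (Surgery.addEdge S).Rel G' G := by
  simp [Op₂, Surgery.addEdge]

lemma exists_isPDI_point_iff {p : V → Prop} :
    (∃ e : point.graph ↪g G', IsPDI point G' e ∧ p (e point.v)) ↔ ∃ v, p v := by
  refine ⟨fun ⟨e, _, h⟩ => ⟨_, h⟩, fun ⟨v, h⟩ => ?_⟩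
  have : Subsingleton (Fin point.order) := inferInstanceAs (Subsingleton (Fin 1))
  refine ⟨⟨⟨fun _ => v, injective_of_subsingleton _⟩, fun {x y} => ?_⟩,
    fun x hx => (hx (Subsingleton.elim _ _)).elim, h⟩
  simp [Subsingleton.elim x y]

lemma op₃_iff : Op₃ G' G ↔ (Surgery.addCherry point).Rel G' G := by
  simp [Op₃, Surgery.addCherry, cons_cons_cons_two, ← exists_isPDI_point_iff (G' := G')]

lemma op₄_iff : Op₄ G' G ↔
    ∃ S ∈ ({T₁, T₂, T₃, T₅, T₆, T₇, T₉, T₁₀, T₁₄} : Set SpecialTree),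
      (Surgery.addPath S).Rel G' G := by
  simp [Op₄, Surgery.addPath, cons_cons_cons_two]

lemma op₅_iff : Op₅ G' G ↔ Surgery.addBoth.Rel G' G := by
  simp [Op₅, Surgery.addBoth, cons_cons_cons_two]

lemma op₆_iff : Op₆ G' G ↔ Surgery.insertPath.Rel G' G := by
  simp [Op₆, Surgery.insertPath, cons_cons_cons_two]

end Operations

/-! ### The table of rules -/

namespace RTree

instance decidableEqVert : (t : RTree) → DecidableEq t.Vert
  | leaf => inferInstanceAs (DecidableEq Unit)
  | join a b =>
    have := decidableEqVert a
    have := decidableEqVert b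
    inferInstanceAs (DecidableEq (a.Vert ⊕ b.Vert))

instance fintypeVert : (t : RTree) → Fintype t.Vert
  | leaf => inferInstanceAs (Fintype Unit)
  | join a b =>
    have := fintypeVert a
    have := fintypeVert b
    inferInstanceAs (Fintype (a.Vert ⊕ b.Vert))

instance decidableAdj : (t : RTree) → DecidableRel t.graph.Adj
  | leaf => fun _ _ => .isFalse fun h => h
  | join a b =>
    fun
    | .inl x, .inl y => decidableAdj a x y
    | .inr x, .inr y => decidableAdj b x y
    | .inl x, .inr y => inferInstanceAs (Decidable (x = a.root ∧ y = b.root))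
    | .inr y, .inl x => inferInstanceAs (Decidable (x = a.root ∧ y = b.root))

/-- The map on the vertices of a rooted tree with values `f 0, f 1, …` in preorder. -/
def label {X : Type*} : (t : RTree) → (ℕ → X) → t.Vert → X
  | leaf, f => fun _ => f 0
  | join a b, f => Sum.elim (a.label f) (b.label fun i => f (i + a.size))

/-- The rooted tree with a single branch `t` at its root. -/
def stem (t : RTree) : RTree := ofList [t]

/-- The path with `n` edges, rooted at an end. -/
def path : ℕ → RTree
  | 0 => leaf
  | n + 1 => stem (path n)

/-- The path with two edges, rooted at its centre. -/
def cherry : RTree := ofList [leaf, leaf]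

/-- Two paths with three edges that share the root. -/
def twin : RTree := ofList [path 2, path 2]

/-- The path with `n + 2` edges rooted at an end, with an additional leaf at each of its first `n`
vertices. -/
def comb : ℕ → RTree
  | 0 => path 2
  | n + 1 => ofList [leaf, comb n]

end RTree

lemma rootedIso_of_label {V : Type*} [Finite V] {G : SimpleGraph V} {w : V} {t : RTree}
    (f : ℕ → V) (hcard : Nat.card V = t.size) (hroot : t.label f t.root = w)
    (hinj : Injective (t.label f))
    (hadj : ∀ x y, G.Adj (t.label f x) (t.label f y) ↔ t.graph.Adj x y) :
    RootedIso G w t.graph t.root := by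
  have := Fintype.ofFinite V
  have hbij : Bijective (t.label f) := by
    rw [Fintype.bijective_iff_injective_and_card, ← Nat.card_eq_fintype_card,
      ← Nat.card_eq_fintype_card, t.card_vert, hcard]
    exact ⟨hinj, rfl⟩
  exact .symm ⟨⟨Equiv.ofBijective _ hbij, hadj _ _⟩, hroot⟩

instance decidableEdgeGraph (n : ℕ) (l : List (Fin n × Fin n)) :
    DecidableRel (edgeGraph n l).Adj :=
  fun a b => inferInstanceAs (Decidable (a ≠ b ∧ ((a, b) ∈ l ∨ (b, a) ∈ l)))

instance Surgery.decidableAfter (d : Surgery) [DecidableRel d.S.graph.Adj] :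
    DecidableRel d.after.Adj
  | .inl x, .inl y => decidable_of_iff ((d.S.graph.Adj x y ∧ s(x, y) ∉ d.removed) ∨
      (s(.inl x, .inl y) ∈ d.added ∧ x ≠ y)) (by simp [after, apply])
  | .inl x, .inr y => decidable_of_iff (s(.inl x, .inr y) ∈ d.added) (by simp [after, apply])
  | .inr x, .inl y => decidable_of_iff (s(.inr x, .inl y) ∈ d.added) (by simp [after, apply])
  | .inr x, .inr y => decidable_of_iff (s(.inr x, .inr y) ∈ d.added ∧ x ≠ y)
      (by simp [after, apply])

/-- A surgery together with rooted trees that model the special tree, rooted at its white vertex,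
before and after the surgery. The list `labels` enumerates the vertices of `after` in preorder,
with the new vertices numbered after those of the special tree. -/
structure Rule where
  surgery : Surgery
  before : RTree
  after : RTree
  labels : List ℕ
  decAdj : DecidableRel surgery.S.graph.Adj := by exact decidableEdgeGraph _ _

attribute [instance] Rule.decAdj

namespace Rule

variable (ρ : Rule)

/-- The vertex with number `l[i]` of the special tree, where `l` lists the old vertices. -/
def vertBefore (i : ℕ) : Fin ρ.surgery.S.order :=
  let j := (ρ.labels.filter (· < ρ.surgery.S.order)).getD i 0
  if h : j < ρ.surgery.S.order then ⟨j, h⟩ else ρ.surgery.S.white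

/-- The vertex that corresponds to position `i` of the preorder after the surgery. -/
def vertAfter (i : ℕ) : Fin ρ.surgery.S.order ⊕ Fin ρ.surgery.k :=
  let j := ρ.labels.getD i 0
  if h : j < ρ.surgery.S.order then .inl ⟨j, h⟩ else
  if h : j - ρ.surgery.S.order < ρ.surgery.k then .inr ⟨_, h⟩ else .inl ρ.surgery.S.white

open RTree Surgery

/-- The operations that define the family, at each of the special trees they allow. -/
def table : List Rule := [
  .mk (addVertex T₁) cherry (ofList [leaf, leaf, leaf]) [1, 0, 2, 3],
  .mk (addVertex T₂) (path 2) (ofList [leaf, path 1]) [2, 1, 0, 3],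
  .mk (addVertex T₈) (ofList [leaf, path 3]) (ofList [leaf, leaf, path 3]) [1, 2, 3, 4, 5, 0, 6],
  .mk (addEdge T₄) (ofList [leaf, path 1]) (ofList [leaf, path 3]) [1, 2, 3, 4, 5, 0],
  .mk (addEdge T₁₁) (ofList [leaf, leaf, path 3]) (ofList [leaf, leaf, path 5])
    [0, 3, 4, 5, 6, 7, 8, 1, 2],
  .mk (addEdge T₁₂) (comb 2) (ofList [leaf, twin]) [0, 1, 2, 3, 4, 5, 7, 8, 6],
  .mk (addEdge T₁₃) (comb 2) (ofList [path 2, comb 1]) [0, 1, 2, 3, 4, 5, 6, 7, 8],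
  .mk (addEdge T₁₅) (ofList [leaf, leaf, ofList [leaf, cherry]]) (ofList [leaf, leaf, comb 2])
    [3, 2, 1, 0, 8, 9, 4, 5, 6, 7],
  .mk (addCherry point) leaf (stem cherry) [0, 2, 1, 3],
  .mk (addPath T₁) cherry (ofList [leaf, leaf, path 2]) [1, 3, 4, 5, 0, 2],
  .mk (addPath T₂) (path 2) (ofList [path 1, path 2]) [2, 3, 4, 5, 1, 0],
  .mk (addPath T₃) (path 3) (stem (stem (comb 1))) [3, 2, 1, 4, 5, 6, 0],
  .mk (addPath T₅) (comb 1) (ofList [leaf, path 2, path 2]) [1, 2, 3, 4, 5, 6, 7, 0],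
  .mk (addPath T₆) (path 4) (ofList [path 2, path 3]) [4, 3, 2, 1, 0, 5, 6, 7],
  .mk (addPath T₇) (path 5) (stem (stem twin)) [5, 4, 3, 2, 1, 0, 6, 7, 8],
  .mk (addPath T₉) (path 6) (ofList [path 2, path 5]) [6, 5, 4, 3, 2, 1, 0, 7, 8, 9],
  .mk (addPath T₁₀) twin (ofList [path 2, path 2, path 2]) [3, 2, 1, 0, 4, 5, 6, 7, 8, 9],
  .mk (addPath T₁₄) (stem (comb 2)) (ofList [path 2, comb 2]) [0, 1, 2, 3, 4, 5, 6, 7, 8, 9, 10],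
  .mk addBoth (path 4) (ofList [leaf, path 5]) [4, 3, 2, 1, 0, 5, 7, 6],
  .mk insertPath (stem (comb 2)) (stem (stem (comb 3))) [0, 8, 9, 1, 2, 3, 4, 5, 6, 7, 10]]

variable {ρ : Rule}

lemma size_eq : ∀ ρ ∈ table, ρ.surgery.S.order = ρ.before.size ∧
    ρ.surgery.S.order + ρ.surgery.k = ρ.after.size := by
  decide +kernel

lemma size_lt : ∀ ρ ∈ table, ρ.before.size < ρ.after.size := by
  decide +kernel

lemma eval_after : ∀ ρ ∈ table,
    ρ.after.eval = ρ.before.eval.shift (ρ.after.eval.dom0 - ρ.before.eval.dom0) := by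
  decide +kernel

lemma rootedIso_before (hρ : ρ ∈ table) :
    RootedIso ρ.surgery.S.graph ρ.surgery.S.white ρ.before.graph ρ.before.root := by
  have hcheck : ∀ ρ ∈ table, ρ.before.label ρ.vertBefore ρ.before.root = ρ.surgery.S.white ∧
      Injective (ρ.before.label ρ.vertBefore) ∧ ∀ x y,
        ρ.surgery.S.graph.Adj (ρ.before.label ρ.vertBefore x) (ρ.before.label ρ.vertBefore y) ↔
          ρ.before.graph.Adj x y := by
    decide +kernel
  obtain ⟨hroot, hinj, hadj⟩ := hcheck ρ hρ
  exact rootedIso_of_label _ (by rw [Nat.card_fin, (size_eq ρ hρ).1]) hroot hinj hadj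

lemma rootedIso_after (hρ : ρ ∈ table) :
    RootedIso ρ.surgery.after (.inl ρ.surgery.S.white) ρ.after.graph ρ.after.root := by
  have hcheck : ∀ ρ ∈ table, ρ.after.label ρ.vertAfter ρ.after.root = .inl ρ.surgery.S.white ∧
      Injective (ρ.after.label ρ.vertAfter) ∧ ∀ x y,
        ρ.surgery.after.Adj (ρ.after.label ρ.vertAfter x) (ρ.after.label ρ.vertAfter y) ↔
          ρ.after.graph.Adj x y := by
    decide +kernel
  obtain ⟨hroot, hinj, hadj⟩ := hcheck ρ hρ
  refine rootedIso_of_label _ ?_ hroot hinj hadj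
  rw [Nat.card_sum, Nat.card_fin, Nat.card_fin, (size_eq ρ hρ).2]

end Rule

lemma op_iff {V W : Type u} {G' : SimpleGraph V} {G : SimpleGraph W} :
    Op₁ G' G ∨ Op₂ G' G ∨ Op₃ G' G ∨ Op₄ G' G ∨ Op₅ G' G ∨ Op₆ G' G ↔
      ∃ ρ ∈ Rule.table, ρ.surgery.Rel G' G := by
  simp [op₁_iff, op₂_iff, op₃_iff, op₄_iff, op₅_iff, op₆_iff, Rule.table, or_assoc]

/-! ### Balanced rooted trees are reducible -/

namespace RTree

/-- The rooted tree `t` arises from a smaller one by a rule of the table. -/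
def IsReducible (t : RTree) : Prop := ∃ ρ ∈ Rule.table, ∃ C : Context, Iso t (C.plug ρ.after)

namespace IsReducible

variable {s t : RTree}

lemma of_iso (h : Iso s t) : IsReducible t → IsReducible s :=
  fun ⟨ρ, hρ, C, hC⟩ => ⟨ρ, hρ, C, h.trans hC⟩

lemma join_left (h : IsReducible s) (t : RTree) : IsReducible (s.join t) :=
  let ⟨ρ, hρ, C, hC⟩ := h
  ⟨ρ, hρ, .left C t, hC.join (.refl t)⟩

lemma join_right (s : RTree) (h : IsReducible t) : IsReducible (s.join t) :=
  let ⟨ρ, hρ, C, hC⟩ := h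
  ⟨ρ, hρ, .right s C, (Iso.refl s).join hC⟩

lemma of_subperm {ρ : Rule} (hρ : ρ ∈ Rule.table) (h : ρ.after.children.Subperm t.children) :
    IsReducible t :=
  ⟨ρ, hρ, exists_iso_plug_of_subperm h⟩

end IsReducible

/-- The rooted trees of excess `0` that are not reducible, up to isomorphism. -/
def normalForms : List RTree :=
  [leaf, path 1, cherry, path 2, path 3, comb 1, twin, path 4, stem (comb 1), comb 2, stem twin,
    path 5, stem (comb 2), comb 3, path 6, stem (comb 3)]

lemma normalForms_join : ∀ a ∈ normalForms, ∀ b ∈ normalForms,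
    0 < (join a b).eval.excess ∨
      (∃ ρ ∈ Rule.table, ρ.after.children.Subperm (join a b).children) ∨
      ∃ c ∈ normalForms, (join a b).children.Perm c.children := by
  decide +kernel

lemma excess_pos_or_isReducible_or_exists_iso (t : RTree) :
    0 < t.eval.excess ∨ IsReducible t ∨ ∃ c ∈ normalForms, Iso t c := by
  induction t with
  | leaf => exact .inr (.inr ⟨leaf, by decide, .refl _⟩)
  | join a b iha ihb =>
    have excess_le := excess_add_excess_le a b
    have ha_nonneg := excess_nonneg a
    have hb_nonneg := excess_nonneg b
    obtain ha | ha | ⟨a', ha', hiso_a⟩ := iha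
    · exact .inl (by omega)
    · exact .inr (.inl (ha.join_left b))
    obtain hb | hb | ⟨b', hb', hiso_b⟩ := ihb
    · exact .inl (by omega)
    · exact .inr (.inl (hb.join_right a))
    have hiso := hiso_a.join hiso_b
    obtain hpos | ⟨ρ, hρ, hsub⟩ | ⟨c, hc, hperm⟩ := normalForms_join a' ha' b' hb'
    · exact .inl (hiso.eval_eq ▸ hpos)
    · exact .inr (.inl (.of_iso hiso (.of_subperm hρ hsub)))
    · exact .inr (.inr ⟨c, hc, hiso.trans (.of_children_perm hperm)⟩)

-- Exchanging `a` and `b` moves the root to one of its children.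
lemma normalForms_reroot : ∀ t ∈ normalForms, t.size ≤ 4 ∨ t.eval.dom2 ≠ t.eval.ind2 ∨
    ∃ a ∈ normalForms, ∃ b ∈ normalForms, t.children.Perm (join a b).children ∧
      ∃ ρ ∈ Rule.table, ρ.after.children.Subperm (join b a).children := by
  decide +kernel

lemma exists_iso_isReducible (t : RTree) (hbal : t.eval.dom2 = t.eval.ind2) (hsize : 4 < t.size) :
    ∃ s, Nonempty (t.graph ≃g s.graph) ∧ IsReducible s := by
  obtain hpos | hred | ⟨c, hc, hiso⟩ := t.excess_pos_or_isReducible_or_exists_iso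
  · have excess_le : t.eval.excess ≤ t.eval.ind2 - t.eval.dom2 := min_le_left _ _
    omega
  · exact ⟨t, ⟨.refl⟩, hred⟩
  · obtain hsmall | hne | ⟨a, -, b, -, hperm, ρ, hρ, hsub⟩ := normalForms_reroot c hc
    · exact absurd hsize (hiso.size_eq ▸ hsmall.not_gt)
    · exact absurd (hiso.eval_eq ▸ hbal) hne
    · obtain ⟨φ⟩ := (hiso.trans (.of_children_perm hperm)).nonempty_iso
      exact ⟨join b a, ⟨φ.trans (attachComm _ _ _ _)⟩, .of_subperm hρ hsub⟩

/-! ### Small rooted trees -/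

lemma size_pos : (t : RTree) → 0 < t.size
  | leaf => Nat.one_pos
  | join a _ => Nat.add_pos_left a.size_pos _

/-- A list that contains all rooted trees with at most `n` vertices. -/
def upToSize : ℕ → List RTree
  | 0 => []
  | n + 1 => leaf :: (upToSize n).flatMap fun a => (upToSize n).map a.join

lemma mem_upToSize {n : ℕ} : {t : RTree} → t.size ≤ n → t ∈ upToSize n := by
  induction n with
  | zero => exact fun {t} h => absurd h t.size_pos.not_ge
  | succ n ih =>
    rintro (_ | ⟨a, b⟩) h
    · exact List.mem_cons_self
    · have ha := a.size_pos
      have hb := b.size_pos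
      rw [size] at h
      refine List.mem_cons_of_mem _ (List.mem_flatMap.2 ⟨a, ih (by omega), ?_⟩)
      exact List.mem_map_of_mem (ih (by omega))

lemma isBalanced_of_size_le_four {t : RTree} (h : t.size ≤ 4) : IsBalanced t.graph := by
  have hcheck : ∀ s ∈ upToSize 4, s.size ≤ 4 → s.eval.dom2 = s.eval.ind2 := by
    decide +kernel
  exact t.isBalanced_graph_iff.2 (hcheck t (mem_upToSize h) h)

end RTree

/-! ### Finite trees and rooted trees -/

section Trees

variable {V W : Type*} [Finite V] [Finite W] {G : SimpleGraph V} {H : SimpleGraph W}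

lemma isTree_attach_singleton (hG : G.IsTree) (hH : H.IsTree) (v : V) (w : W) :
    (attach G v H {w}).IsTree := by
  rw [SimpleGraph.isTree_iff_connected_and_card] at hG hH ⊢
  rw [attach_singleton_eq, SimpleGraph.edgeSet_sup, SimpleGraph.edgeSet_edge_of_ne Sum.inl_ne_inr,
    union_singleton]
  refine ⟨hG.1.sum_sup_edge hH.1, ?_⟩
  rw [Nat.card_coe_set_eq, ncard_insert_of_notMem (by simp), ← Nat.card_coe_set_eq,
    Nat.card_congr SimpleGraph.edgeSetSumEquiv, Nat.card_sum, Nat.card_sum, ← hG.2, ← hH.2]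
  omega

omit [Finite V] in
lemma exists_iso_attach_induce_compl {x y : V} (hx : ∀ z, G.Adj x z ↔ z = y) :
    ∃ y' : ({x}ᶜ : Set V),
      Nonempty (G ≃g attach (G.induce {x}ᶜ) y' (⊥ : SimpleGraph Unit) {()}) := by
  have hbij : Bijective (Sum.elim Subtype.val fun _ => x : ({x}ᶜ : Set V) ⊕ Unit → V) := by
    refine ⟨Subtype.val_injective.sumElim (fun _ _ _ => rfl) fun a _ h => a.2 h, fun v => ?_⟩
    by_cases hv : v = x
    · exact ⟨.inr (), hv.symm⟩
    · exact ⟨.inl ⟨v, hv⟩, rfl⟩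
  refine ⟨⟨y, ((hx y).2 rfl).ne'⟩, ⟨.symm ⟨.ofBijective _ hbij, ?_⟩⟩⟩
  rintro (z | z) (w | w) <;> simp [hx, G.adj_comm _ x, Subtype.ext_iff]

namespace RTree

lemma isTree_graph : (t : RTree) → t.graph.IsTree
  | leaf => SimpleGraph.IsTree.of_subsingleton (V := Unit)
  | join a b => isTree_attach_singleton a.isTree_graph b.isTree_graph a.root b.root

lemma exists_rootedIso_attach_leaf (t : RTree) (v : t.Vert) : ∃ t' : RTree,
    RootedIso (attach t.graph v (⊥ : SimpleGraph Unit) {()}) (.inl t.root) t'.graph t'.root := by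
  induction t with
  | leaf => exact ⟨join leaf leaf, .refl _ _⟩
  | join a b iha ihb =>
    obtain v | v := v
    · obtain ⟨a', ha'⟩ := iha v
      exact ⟨join a' b, .trans ⟨attachSwap _ _ _ _ _ _ _, rfl⟩ (ha'.attach_inl (.refl _ _))⟩
    · obtain ⟨b', φ, hφ⟩ := ihb v
      exact ⟨join a b', (attachAssocRight _ _ _ _ _ _ _).trans
        (attachCongr .refl rfl φ (by simp [← hφ])), rfl⟩

lemma exists_iso_of_isTree (hG : G.IsTree) : ∃ t : RTree, Nonempty (G ≃g t.graph) := by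
  induction hn : Nat.card V using Nat.strong_induction_on generalizing V with
  | _ n ih =>
  subst hn
  have := hG.connected.nonempty
  obtain hsub | hnontriv := subsingleton_or_nontrivial V
  · have := uniqueOfSubsingleton (Classical.arbitrary V)
    exact ⟨leaf, ⟨.ofUnique V Unit, by simp [Subsingleton.elim _ (default : V)]⟩⟩
  classical
  have := Fintype.ofFinite V
  obtain ⟨x, hx⟩ := hG.exists_vert_degree_one_of_nontrivial
  have hconn := hG.connected.induce_compl_singleton_of_degree_eq_one hx
  obtain ⟨y, hxy, hy⟩ := SimpleGraph.degree_eq_one_iff_existsUnique_adj.1 hx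
  obtain ⟨y', ⟨ψ⟩⟩ := exists_iso_attach_induce_compl fun z => ⟨hy z, fun h => h ▸ hxy⟩
  obtain ⟨t, ⟨φ⟩⟩ := ih _ (Finite.card_subtype_lt (not_not_intro rfl))
    ⟨hconn, hG.isAcyclic.induce {x}ᶜ⟩ rfl
  obtain ⟨t', ht'⟩ := t.exists_rootedIso_attach_leaf (φ y')
  obtain ⟨χ⟩ := ht'.nonempty_iso
  exact ⟨t', ⟨ψ.trans ((attachCongr φ rfl .refl fun _ => Iff.rfl).trans χ)⟩⟩

end RTree

end Trees

/-! ### The characterization -/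

lemma Surgery.Rel.finite {V W : Type u} [Finite V] {d : Surgery} {G' : SimpleGraph V}
    {G : SimpleGraph W} : d.Rel G' G → Finite W := fun ⟨_, _, ⟨ψ⟩⟩ => .of_equiv _ ψ.toEquiv.symm

namespace Rule

variable {ρ : Rule}

lemma exists_profile_eq_shift (hρ : ρ ∈ table) : ∃ k,
    profile ρ.surgery.after (.inl ρ.surgery.S.white) =
      (profile ρ.surgery.S.graph ρ.surgery.S.white).shift k := by
  rw [(rootedIso_after hρ).profile_eq, (rootedIso_before hρ).profile_eq,
    RTree.profile_eq_eval, RTree.profile_eq_eval]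
  exact ⟨_, eval_after ρ hρ⟩

lemma isBalanced_iff_of_rel (hρ : ρ ∈ table) {V W : Type u} [Finite V] {G' : SimpleGraph V}
    {G : SimpleGraph W} (h : ρ.surgery.Rel G' G) : IsBalanced G ↔ IsBalanced G' := by
  obtain ⟨k, hk⟩ := exists_profile_eq_shift hρ
  obtain ⟨Y, _, L, N, ⟨φ⟩, ⟨ψ⟩⟩ := h.exists_iso_attach
  rw [isBalanced_congr φ, isBalanced_congr ψ, isBalanced_attach_iff hk]

lemma rel_plug (hρ : ρ ∈ table) (C : RTree.Context) {V W : Type*} {G' : SimpleGraph V}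
    {G : SimpleGraph W} (φ : G' ≃g (C.plug ρ.before).graph) (ψ : G ≃g (C.plug ρ.after).graph) :
    ρ.surgery.Rel G' G := by
  obtain ⟨Y, _, L, N, hplug⟩ := C.exists_iso_attach
  obtain ⟨α⟩ := hplug ρ.before
  obtain ⟨β⟩ := hplug ρ.after
  obtain ⟨γ, hγ⟩ := rootedIso_before hρ
  obtain ⟨δ, hδ⟩ := rootedIso_after hρ
  exact .of_iso_attach ((attachCongr γ hγ .refl fun _ => Iff.rfl).trans (φ.trans α).symm)
    ((ψ.trans β).trans (attachCongr δ hδ .refl fun _ => Iff.rfl).symm)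

end Rule

lemma RTree.Context.size_plug_lt_size_plug {s t : RTree} (h : s.size < t.size) (C : Context) :
    (C.plug s).size < (C.plug t).size := by
  induction C with
  | hole => exact h
  | left C b ih => exact Nat.add_lt_add_right ih _
  | right a C ih => exact Nat.add_lt_add_left ih _

namespace TreeFamily

lemma of_op {V W : Type u} {G' : SimpleGraph V} {G : SimpleGraph W} (hG' : TreeFamily G') :
    Op₁ G' G ∨ Op₂ G' G ∨ Op₃ G' G ∨ Op₄ G' G ∨ Op₅ G' G ∨ Op₆ G' G → TreeFamily G := by
  rintro (h | h | h | h | h | h)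
  exacts [.op₁ hG' h, .op₂ hG' h, .op₃ hG' h, .op₄ hG' h, .op₅ hG' h, .op₆ hG' h]

lemma of_isBalanced {V : Type u} {G : SimpleGraph V} (t : RTree) (φ : G ≃g t.graph)
    (hG : IsBalanced G) : TreeFamily G := by
  induction hn : t.size using Nat.strong_induction_on generalizing t V with
  | _ n ih =>
  subst hn
  have : Finite V := .of_equiv _ φ.toEquiv.symm
  obtain hsize | hsize := le_or_gt t.size 4
  · exact .small G (φ.isTree_iff.2 t.isTree_graph)
      (by rwa [Nat.card_congr φ.toEquiv, t.card_vert])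
  · have ht : t.eval.dom2 = t.eval.ind2 := t.isBalanced_graph_iff.1 ((isBalanced_congr φ).1 hG)
    obtain ⟨s, ⟨χ⟩, ρ, hρ, C, hC⟩ := t.exists_iso_isReducible ht hsize
    obtain ⟨ψ⟩ := hC.nonempty_iso
    let G' : SimpleGraph (ULift.{u} (C.plug ρ.before).Vert) :=
      (C.plug ρ.before).graph.comap ULift.down
    let ι : G' ≃g (C.plug ρ.before).graph := ⟨Equiv.ulift, Iff.rfl⟩
    have hrel : ρ.surgery.Rel G' G := Rule.rel_plug hρ C ι ((φ.trans χ).trans ψ)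
    have hlt : (C.plug ρ.before).size < t.size := by
      rw [← t.card_vert, Nat.card_congr (χ.trans ψ).toEquiv, RTree.card_vert]
      exact C.size_plug_lt_size_plug (Rule.size_lt ρ hρ)
    have hG' : IsBalanced G' := (Rule.isBalanced_iff_of_rel hρ hrel).1 hG
    exact (ih _ hlt _ ι hG' rfl).of_op (op_iff.2 ⟨ρ, hρ, hrel⟩)

lemma finite_and_isBalanced {V : Type u} {G : SimpleGraph V} (h : TreeFamily G) :
    Finite V ∧ IsBalanced G := by
  have step {V W : Type u} {G' : SimpleGraph V} {G : SimpleGraph W}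
      (hop : Op₁ G' G ∨ Op₂ G' G ∨ Op₃ G' G ∨ Op₄ G' G ∨ Op₅ G' G ∨ Op₆ G' G) :
      Finite V ∧ IsBalanced G' → Finite W ∧ IsBalanced G := fun ⟨_, hG'⟩ =>
    let ⟨_, hρ, hrel⟩ := op_iff.1 hop
    ⟨hrel.finite, (Rule.isBalanced_iff_of_rel hρ hrel).2 hG'⟩
  induction h with
  | @small V hV G hG hcard =>
    obtain ⟨t, ⟨φ⟩⟩ := RTree.exists_iso_of_isTree hG
    rw [Nat.card_congr φ.toEquiv, t.card_vert] at hcard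
    exact ⟨hV, (isBalanced_congr φ).2 (RTree.isBalanced_of_size_le_four hcard)⟩
  | op₁ _ h ih => exact step (by tauto) ih
  | op₂ _ h ih => exact step (by tauto) ih
  | op₃ _ h ih => exact step (by tauto) ih
  | op₄ _ h ih => exact step (by tauto) ih
  | op₅ _ h ih => exact step (by tauto) ih
  | op₆ _ h ih => exact step (by tauto) ih

end TreeFamily

end TwoDom

theorem theorem1 {V : Type u} [Finite V] (T : SimpleGraph V) (hT : T.IsTree) :
    TwoDom.kDominationNumber T 2 = TwoDom.kIndependenceNumber T 2 ↔ TwoDom.TreeFamily T := by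
  refine ⟨fun h => ?_, fun h => h.finite_and_isBalanced.2⟩
  obtain ⟨t, ⟨φ⟩⟩ := TwoDom.RTree.exists_iso_of_isTree hT
  exact .of_isBalanced t φ h
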